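/- Let $X$ be a (connected) complex projective manifold, let $q>2$ be an integer, and let $\mathcal G=(T_{\mathcal G},N^*_{\mathcal G})$ be a codimension-$q$ singular holomorphic foliation on $X$, i.e. a pair of subsheaves $T_{\mathcal G}\subset T_X$, $N^*_{\mathcal G}\subset\Omega^1_X$, each the annihilator of the other, with $T_{\mathcal G}$ closed under Lie brackets and $N^*_{\mathcal G}$ of generic rank $q$. A codimension-one foliation $\mathcal F$ contains $\mathcal G$ if $T_{\mathcal G}\subset T_{\mathcal F}$. Let $\Omega^1_{\mathcal G}$ be the dual of $T_{\mathcal G}$, let $\mathscr M_X$ be the sheaf of rational functions, let $\mathbb C(X)$ be the field of rational functions of $X$, and let $\mathbb C(X/\mathcal G)\subset\mathbb C(X)$ be the field of rational first integrals of $\mathcal G$ (the rational functions annihilated by all rational sections of $T_{\mathcal G}$). For $\eta\in H^0(X,\Omega^1_{\mathcal G}\otimes\mathscr M_X)$ put $$\mathsf E^1_{\mathcal G}(\eta)=\{\omega\in H^0(X,N^*_{\mathcal G}\otimes\mathscr M_X)\;;\;\nabla\omega=\eta\otimes\omega\},$$ where $\nabla$ is Bott's partial connection on $N^*_{\mathcal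 G}$, that is, $(\nabla_v\omega)(\xi)=v(\omega(\xi))-\omega([v,\xi])$ for rational sections $v$ of $T_{\mathcal G}$ and rational vector fields $\xi$. One says that $\eta$ is log-exact if $\eta=\frac{df}{f}\big|_{T_{\mathcal G}}$ for some nonzero $f\in\mathbb C(X)$, and that $\mathsf E^1_{\mathcal G}(\eta)$ generates $\mathcal G$ if it generates the $\mathbb C(X)$-vector space $H^0(X,N^*_{\mathcal G}\otimes\mathscr M_X)$. Assume that $\eta$ is not log-exact and that $\mathsf E^1_{\mathcal G}(\eta)$ generates $\mathcal G$. Then: 1. The general leaf of $\mathcal G$ is Zariski dense: there are countably many proper Zariski closed subsets of $X$ such that the leaf of $\mathcal G$ through every nonsingular point outside of them is Zariski dense in $X$; and $\mathbb C(X/\mathcal G)=\mathbb C$. 2. Every codimension-one foliation $\mathcal F$ containing $\mathcal G$ is (singularly) transversely affine: it is defined by a nonzero rational $1$-form $\omega$ such that $d\omega=\theta\wedge\omega$ for some closed rational $1$-form $\theta$. 3. The set of codimension-one foliations containing $\mathcal G$ is parametrized by $\mathbb P^{q-1}(\mathbb C)$: the complex vector space $\mathsf E^1_{\mathcal G}(\eta)$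 has a basis $\omega_1,\dots,\omega_q$ such that every form $s_1\omega_1+\dots+s_q\omega_q$ with $s\in\mathbb C^q\setminus\{0\}$ defines a codimension-one foliation containing $\mathcal G$, and the map sending $(s_1:\dots:s_q)$ to this foliation is a bijection from $\mathbb P^{q-1}(\mathbb C)$ onto the set of codimension-one foliations containing $\mathcal G$. -/

import Mathlib

open AlgebraicGeometry CategoryTheory

open scoped KaehlerDifferential LinearAlgebra.Projectivization

noncomputable section

attribute [local instance] MvPolynomial.gradedAlgebra

/-- The structure morphism `ℙ^N → Spec ℂ` of the projective space `Proj ℂ[x₀, …, x_N]`. -/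
def projectiveSpaceStr (N : ℕ) :
    Proj (MvPolynomial.homogeneousSubmodule (Fin (N + 1)) ℂ) ⟶ Spec (.of ℂ) :=
  Proj.toSpecZero (MvPolynomial.homogeneousSubmodule (Fin (N + 1)) ℂ) ≫
    Spec.map (CommRingCat.ofHom
      (algebraMap ℂ (MvPolynomial.homogeneousSubmodule (Fin (N + 1)) ℂ 0)))

/-- A (connected) complex projective manifold: an integral scheme, smooth over `Spec ℂ`, which
admits a closed immersion over `Spec ℂ` into some projective space. -/
structure ProjectiveManifold where
  toScheme : Scheme.{0}
  str : toScheme ⟶ Spec (.of ℂ)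
  [isIntegral : IsIntegral toScheme]
  [smooth : Smooth str]
  projective : ∃ (N : ℕ)
    (i : toScheme ⟶ Proj (MvPolynomial.homogeneousSubmodule (Fin (N + 1)) ℂ)),
      IsClosedImmersion i ∧ i ≫ projectiveSpaceStr N = str

namespace ProjectiveManifold

attribute [instance] ProjectiveManifold.isIntegral ProjectiveManifold.smooth

variable (X : ProjectiveManifold)

/-- The ring homomorphism sending a complex number to the constant function on `U`. -/
def const (U : X.toScheme.Opens) : ℂ →+* Γ(X.toScheme, U) :=
  ((Scheme.ΓSpecIso (.of ℂ)).inv ≫ X.str.appTop ≫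
    X.toScheme.presheaf.map (homOfLE le_top).op).hom

instance algebraSections (U : X.toScheme.Opens) : Algebra ℂ Γ(X.toScheme, U) :=
  (X.const U).toAlgebra

/-- The field `ℂ(X)` of rational functions. -/
abbrev RatFun : Type := X.toScheme.functionField

instance algebraRatFun : Algebra ℂ X.RatFun :=
  ((X.toScheme.presheaf.germ ⊤ (genericPoint X.toScheme) trivial).hom.comp
    (X.const ⊤)).toAlgebra

/-- Restriction of functions. -/
def restrict {U V : X.toScheme.Opens} (h : V ≤ U) :
    Γ(X.toScheme, U) →+* Γ(X.toScheme, V) :=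
  (X.toScheme.presheaf.map (homOfLE h).op).hom

theorem restrict_const {U V : X.toScheme.Opens} (h : V ≤ U) (c : ℂ) :
    X.restrict h (algebraMap ℂ Γ(X.toScheme, U) c) = algebraMap ℂ Γ(X.toScheme, V) c := by
  have H : ((Scheme.ΓSpecIso (.of ℂ)).inv ≫ X.str.appTop ≫
      X.toScheme.presheaf.map (homOfLE (le_top : U ≤ ⊤)).op) ≫
        X.toScheme.presheaf.map (homOfLE h).op =
      (Scheme.ΓSpecIso (.of ℂ)).inv ≫ X.str.appTop ≫
        X.toScheme.presheaf.map (homOfLE (le_top : V ≤ ⊤)).op := by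
    rw [Category.assoc, Category.assoc, ← Functor.map_comp]
    rfl
  exact congrArg (fun φ => φ.hom c) H

instance scalarTowerRatFun (U : X.toScheme.Opens) [Nonempty U] :
    IsScalarTower ℂ Γ(X.toScheme, U) X.RatFun :=
  IsScalarTower.of_algebraMap_eq fun c => by
    change (X.toScheme.presheaf.germ ⊤ (genericPoint X.toScheme) trivial).hom (X.const ⊤ c) =
      (X.toScheme.germToFunctionField U).hom (algebraMap ℂ Γ(X.toScheme, U) c)
    rw [← X.restrict_const (le_top : U ≤ ⊤) c]
    exact (X.toScheme.presheaf.germ_res_apply (homOfLE le_top) _ _ _).symm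

/-- Restriction of regular `1`-forms from an affine open set to a smaller one:
the additive map with `g • df ↦ g|_V • d(f|_V)`. -/
def restrictForm {U V : X.toScheme.Opens} (h : V ≤ U) :
    Ω[Γ(X.toScheme, U)⁄ℂ] →+ Ω[Γ(X.toScheme, V)⁄ℂ] :=
  letI : Algebra Γ(X.toScheme, U) Γ(X.toScheme, V) := (X.restrict h).toAlgebra
  haveI : IsScalarTower ℂ Γ(X.toScheme, U) Γ(X.toScheme, V) :=
    IsScalarTower.of_algebraMap_eq fun c => (X.restrict_const h c).symm
  (KaehlerDifferential.map ℂ ℂ Γ(X.toScheme, U) Γ(X.toScheme, V)).toAddMonoidHom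

/-- Rational `1`-forms on `X`, the elements of `H⁰(X, Ω¹_X ⊗ 𝓜_X)`. -/
abbrev RatForm : Type := Ω[X.RatFun⁄ℂ]

/-- Rational vector fields on `X`. -/
abbrev RatVectorField : Type := Derivation ℂ X.RatFun X.RatFun

/-- A regular `1`-form on a nonempty affine open set, seen as a rational `1`-form. -/
def toRatForm (U : X.toScheme.Opens) [Nonempty U] :
    Ω[Γ(X.toScheme, U)⁄ℂ] →ₗ[Γ(X.toScheme, U)] X.RatForm :=
  KaehlerDifferential.map ℂ ℂ Γ(X.toScheme, U) X.RatFun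

variable {X}

/-- The contraction `ω(v)` of a rational `1`-form with a rational vector field. -/
def contract (ω : X.RatForm) (v : X.RatVectorField) : X.RatFun :=
  v.liftKaehlerDifferential ω

/-- The exterior derivative of a rational `1`-form, evaluated on two rational vector fields:
`dω(v, w) = v(ω(w)) - w(ω(v)) - ω([v, w])`. -/
def exteriorDerivative (ω : X.RatForm) (v w : X.RatVectorField) : X.RatFun :=
  v (contract ω w) - w (contract ω v) - contract ω ⁅v, w⁆

/-- The wedge product of two rational `1`-forms, evaluated on two rational vector fields. -/
def wedge (θ ω : X.RatForm) (v w : X.RatVectorField) : X.RatFun :=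
  contract θ v * contract ω w - contract θ w * contract ω v

variable (X)

/-- The complex points of `X`, that is, the sections of `X → Spec ℂ`. -/
@[ext]
structure Point where
  hom : Spec (.of ℂ) ⟶ X.toScheme
  hom_str : hom ≫ X.str = 𝟙 (Spec (.of ℂ))

variable {X}

/-- The closed point of the scheme `X` underlying a complex point. -/
def Point.toPt (p : X.Point) : X.toScheme :=
  p.hom (IsLocalRing.closedPoint ℂ : Spec (.of ℂ))

/-- The value `f(p)` of a regular function at a complex point of its domain. -/
def Point.eval {U : X.toScheme.Opens} (p : {p : X.Point // ⊤ ≤ p.hom ⁻¹ᵁ U})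
    (f : Γ(X.toScheme, U)) : ℂ :=
  (Scheme.ΓSpecIso (.of ℂ)).hom.hom ((p.1.hom.appLE U ⊤ p.2).hom f)

variable (X)

/-- A singular holomorphic foliation on `X`: a pair of subsheaves `T ⊆ T_X` and `N ⊆ Ω¹_X` of
`𝒪_X`-modules (tangent and conormal sheaf), each the annihilator of the other, with `T` closed
under Lie brackets. The subsheaves are given by their sections on affine open sets, where
`T_X` consists of the derivations and `Ω¹_X` of the Kähler differentials of the coordinate ring. -/
@[ext]
structure Foliation where
  tangent : ∀ U : X.toScheme.affineOpens,
    Submodule Γ(X.toScheme, U) (Derivation ℂ Γ(X.toScheme, U) Γ(X.toScheme, U))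
  conormal : ∀ U : X.toScheme.affineOpens, Submodule Γ(X.toScheme, U) Ω[Γ(X.toScheme, U)⁄ℂ]
  /-- `T` is stable under restriction: if `v ∈ T(U)` and `w` is the vector field on `V ⊆ U`
  which is the restriction of `v`, then `w ∈ T(V)`. -/
  tangent_restrict : ∀ (U V : X.toScheme.affineOpens) (h : V.1 ≤ U.1), ∀ v ∈ tangent U,
    ∀ w : Derivation ℂ Γ(X.toScheme, V) Γ(X.toScheme, V),
      (∀ f, w (X.restrict h f) = X.restrict h (v f)) → w ∈ tangent V
  conormal_restrict : ∀ (U V : X.toScheme.affineOpens) (h : V.1 ≤ U.1), ∀ ω ∈ conormal U,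
    X.restrictForm h ω ∈ conormal V
  mem_tangent_iff : ∀ (U : X.toScheme.affineOpens)
    (v : Derivation ℂ Γ(X.toScheme, U) Γ(X.toScheme, U)),
    v ∈ tangent U ↔ ∀ ω ∈ conormal U, v.liftKaehlerDifferential ω = 0
  mem_conormal_iff : ∀ (U : X.toScheme.affineOpens) (ω : Ω[Γ(X.toScheme, U)⁄ℂ]),
    ω ∈ conormal U ↔ ∀ v ∈ tangent U, v.liftKaehlerDifferential ω = 0
  involutive : ∀ U : X.toScheme.affineOpens, ∀ v ∈ tangent U, ∀ w ∈ tangent U,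
    ⁅v, w⁆ ∈ tangent U

namespace Foliation

variable {X} (F G : X.Foliation)

/-- The rational sections of the conormal sheaf: the `ℂ(X)`-vector space
`H⁰(X, N*_F ⊗ 𝓜_X)` of rational `1`-forms. -/
def ratConormal : Submodule X.RatFun X.RatForm :=
  Submodule.span X.RatFun {ω | ∃ (U : X.toScheme.affineOpens) (_ : Nonempty U.1),
    ∃ α ∈ F.conormal U, ω = X.toRatForm U.1 α}

/-- The rational sections of the tangent sheaf: the `ℂ(X)`-vector space of rational vector
fields generated by those which extend some section of the tangent sheaf. -/
def ratTangent : Submodule X.RatFun X.RatVectorField :=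
  Submodule.span X.RatFun {v | ∃ (U : X.toScheme.affineOpens) (_ : Nonempty U.1),
    ∃ w ∈ F.tangent U, ∀ f : Γ(X.toScheme, U.1),
      v (algebraMap Γ(X.toScheme, U.1) X.RatFun f) = algebraMap Γ(X.toScheme, U.1) X.RatFun (w f)}

/-- The codimension of a foliation is the generic rank of its conormal sheaf. -/
def codim : ℕ := Module.finrank X.RatFun F.ratConormal

/-- `F` contains `G`: the tangent sheaf of `F` contains the tangent sheaf of `G`. -/
def Contains : Prop := ∀ U : X.toScheme.affineOpens, G.tangent U ≤ F.tangent U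

/-- `F` is the codimension one foliation defined by the nonzero rational `1`-form `ω`. -/
def IsDefinedBy (ω : X.RatForm) : Prop := ω ≠ 0 ∧ F.ratConormal = Submodule.span X.RatFun {ω}

/-- A codimension one foliation is (singularly) transversely affine if it is defined by a rational
`1`-form `ω` such that `dω = θ ∧ ω` for some closed rational `1`-form `θ`. -/
def IsTransverselyAffine : Prop :=
  ∃ ω θ : X.RatForm, F.IsDefinedBy ω ∧
    exteriorDerivative ω = wedge θ ω ∧ exteriorDerivative θ = 0

/-- The field `ℂ(X/F)` of rational first integrals. -/
def firstIntegrals : IntermediateField ℂ X.RatFun where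
  carrier := {f | ∀ v ∈ F.ratTangent, v f = 0}
  mul_mem' := fun {a b} ha hb v hv => by simp [Derivation.leibniz, ha v hv, hb v hv]
  add_mem' := fun {a b} ha hb v hv => by simp [ha v hv, hb v hv]
  algebraMap_mem' := fun c v _ => v.map_algebraMap c
  inv_mem' := fun f hf v hv => by simp [Derivation.leibniz_inv, hf v hv]

instance scalarTowerFirstIntegrals : IsScalarTower ℂ F.firstIntegrals X.RatForm :=
  ⟨fun c a ω => smul_assoc c (a : X.RatFun) ω⟩

/-- The rational sections of `Ω¹_F`, the dual of the tangent sheaf: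
`H⁰(X, Ω¹_F ⊗ 𝓜_X)`. -/
abbrev RatLeafForm : Type := Module.Dual X.RatFun F.ratTangent

/-- `η` is log-exact if it is the restriction of `df / f` to the tangent sheaf, for some nonzero
rational function `f`. -/
def IsLogExact (η : F.RatLeafForm) : Prop :=
  ∃ f : X.RatFun, f ≠ 0 ∧ ∀ v : F.ratTangent, η v = v.1 f / f

/-- The eigenspace `E¹(η)` of Bott's partial connection `∇` on the conormal sheaf: the rational
sections `ω` of the conormal sheaf with `∇ω = η ⊗ ω`. Bott's connection on the normal sheaf
is `∇_v ξ = [v, ξ]` modulo the tangent sheaf, and the dual connection on the conormal sheaf is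
given by the product rule `v(ω(ξ)) = (∇_v ω)(ξ) + ω(∇_v ξ)`. -/
def eigenspace (η : F.RatLeafForm) : Submodule F.firstIntegrals X.RatForm where
  carrier := {ω | ω ∈ F.ratConormal ∧ ∀ (v : F.ratTangent) (ξ : X.RatVectorField),
    v.1 (contract ω ξ) - contract ω ⁅v.1, ξ⁆ = η v * contract ω ξ}
  zero_mem' := by
    refine ⟨zero_mem _, fun v ξ => ?_⟩
    simp [contract]
  add_mem' := by
    rintro a b ⟨ha, ha'⟩ ⟨hb, hb'⟩
    refine ⟨add_mem ha hb, fun v ξ => ?_⟩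
    have h1 := ha' v ξ
    have h2 := hb' v ξ
    simp only [contract, map_add] at *
    linear_combination h1 + h2
  smul_mem' := by
    rintro ⟨c, hc⟩ a ⟨ha, ha'⟩
    refine ⟨Submodule.smul_mem F.ratConormal c ha, fun v ξ => ?_⟩
    have h1 := ha' v ξ
    have h2 : v.1 c = 0 := hc v.1 v.2
    have h3 : ∀ w : X.RatVectorField,
        contract ((⟨c, hc⟩ : F.firstIntegrals) • a) w = c * contract a w :=
      fun w => map_smul w.liftKaehlerDifferential c a
    simp only [h3, Derivation.leibniz, smul_eq_mul, h2, mul_zero, add_zero]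
    linear_combination c * h1

/-- `E¹(η)` generates the foliation: it generates the `ℂ(X)`-vector space of rational sections of
the conormal sheaf. -/
def IsGeneratedByEigenspace (η : F.RatLeafForm) : Prop :=
  Submodule.span X.RatFun (F.eigenspace η : Set X.RatForm) = F.ratConormal

/-- The singular set: the points at which `Ω¹_X / N*_F` is not locally free. -/
def sing : Set X.toScheme :=
  {x | ¬ ∃ U : X.toScheme.affineOpens, x ∈ U.1 ∧
    Module.Free Γ(X.toScheme, U) (Ω[Γ(X.toScheme, U)⁄ℂ] ⧸ F.conormal U)}

/-- Two complex points are the endpoints of a leafwise arc: a `C¹` path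
`γ : [0, 1] → X(ℂ)`, contained in some affine open set and in the complement of the singular
set, which is tangent to the foliation, that is, `ω(γ'(t)) = 0` for every
`ω = ∑ gᵢ dfᵢ` in the conormal sheaf. -/
def LeafArc (x y : X.Point) : Prop :=
  ∃ (U : X.toScheme.affineOpens) (γ : ℝ → {p : X.Point // ⊤ ≤ p.hom ⁻¹ᵁ U.1}),
    (γ 0).1 = x ∧ (γ 1).1 = y ∧
    (∀ t ∈ Set.Icc (0 : ℝ) 1, (γ t).1.toPt ∉ F.sing) ∧
    (∀ f : Γ(X.toScheme, U.1),
      ContDiffOn ℝ 1 (fun t => Point.eval (γ t) f) (Set.Icc 0 1)) ∧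
    ∀ (n : ℕ) (g f : Fin n → Γ(X.toScheme, U.1)),
      (∑ i, g i • KaehlerDifferential.D ℂ Γ(X.toScheme, U.1) (f i)) ∈ F.conormal U →
      ∀ t ∈ Set.Icc (0 : ℝ) 1,
        ∑ i, Point.eval (γ t) (g i) *
          derivWithin (fun s => Point.eval (γ s) (f i)) (Set.Icc 0 1) t = 0

/-- The leaf through a nonsingular complex point `x`: the points which can be joined to `x`
by a piecewise `C¹` path tangent to the foliation and avoiding the singular set. -/
def leaf (x : X.Point) : Set X.Point := {y | Relation.ReflTransGen F.LeafArc x y}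

/-- The general leaf is Zariski dense: outside countably many proper Zariski closed
subsets of `X`, the leaf through every nonsingular complex point is Zariski dense. -/
def GeneralLeafZariskiDense : Prop :=
  ∃ Z : ℕ → Set X.toScheme, (∀ n, IsClosed (Z n) ∧ Z n ≠ Set.univ) ∧
    ∀ x : X.Point, x.toPt ∉ F.sing → (∀ n, x.toPt ∉ Z n) →
      Dense (Point.toPt '' F.leaf x)

end Foliation

end ProjectiveManifold

end

/-! Everything takes place at the generic point. Since tangent and conormal sheaf annihilate each
other, a foliation is determined by its `ℂ(X)`-space of rational conormal forms (`ext_ratConormal`),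
and containment is reversed inclusion of these spaces.

Take eigenforms `ω₁, …, ω_q` that form a basis of the rational conormal space, and rational vector
fields `ξⱼ` with `ωᵢ(ξⱼ) = δᵢⱼ`. If `η` is not log-exact, a rational `c` with `v(c) = -η(v) c` for
all `v` tangent to `𝒢` is zero, as otherwise `1/c` would have logarithmic derivative `η`. Two kinds
of functions satisfy this equation.

First, the components of `df` in the frame, for a first integral `f`, because `∇ df = 0`. So `df =
0` and `f` is a constant.

Second, `ω([ξ, ξ'])`, for an eigenform `ω` that kills two basic fields `ξ, ξ'`; this follows from
the Jacobi identity. Applied to `ωᵢ` with `ξⱼ, ξₖ`, and to `ωᵢ + ωᵢ'` with `ξⱼ, ξᵢ - ξᵢ'`, its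
vanishing gives one form `α` with `dωᵢ = α ∧ ωᵢ` for all `i` (`exists_connection_form`). Then `dα ∧
ωᵢ = 0` for all `i`, and `q > 2` forces `dα = 0`.

By linearity each constant combination `ω_s = ∑ sᵢ ωᵢ` satisfies `dω_s = α ∧ ω_s`, so it is
integrable and transversely affine. Conversely, if `ω` defines some `ℱ ⊇ 𝒢`, involutivity of `ℱ`
gives `∇_v ω = b ω`. Quotients of components of `ω` are then first integrals, hence constants, and
`ω` is proportional to some `ω_s`.

Density of the general leaf needs only that first integrals are constant. A regular function
vanishing on a leaf has all its iterated derivatives along `𝒢` vanishing there, because integral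
curves stay in the leaf. For each finite part of a countable basis of `𝒪(U)` some generalized
Wronskian is nonzero. At a point off the zeros of these countably many Wronskians, a regular
function whose iterated derivatives all vanish must be zero. -/

/-! ### Extending derivations along formally étale maps -/

section Extension

variable {k A B : Type} [Field k] [CommRing A] [CommRing B] [Algebra k A] [Algebra k B]
  [Algebra A B]

/-- The derivation `w` of the `A`-algebra `B` restricts to `v` on `A`. -/
def Derivation.Extends (w : Derivation k B B) (v : Derivation k A A) : Prop :=
  ∀ a, w (algebraMap A B a) = algebraMap A B (v a)

theorem Derivation.Extends.lift_map [IsScalarTower k A B] {w : Derivation k B B}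
    {v : Derivation k A A} (h : w.Extends v) (α : Ω[A⁄k]) :
    w.liftKaehlerDifferential (KaehlerDifferential.map k k A B α) =
      algebraMap A B (v.liftKaehlerDifferential α) := by
  have : (w.liftKaehlerDifferential.restrictScalars A) ∘ₗ (KaehlerDifferential.map k k A B) =
      (Algebra.linearMap A B) ∘ₗ v.liftKaehlerDifferential := by
    apply Derivation.liftKaehlerDifferential_unique
    ext a
    simpa using h a
  exact LinearMap.congr_fun this α

/-- For a formally étale map, `Ω[B⁄k]` is the base change of `Ω[A⁄k]`, so the linear form attached
to `v` extends. It is used for localizations. -/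
theorem Derivation.exists_extends [IsScalarTower k A B] [Algebra.FormallyEtale A B]
    (v : Derivation k A A) : ∃ w : Derivation k B B, w.Extends v := by
  have hb := KaehlerDifferential.isBaseChange_of_formallyEtale k A B
  let l : Ω[B⁄k] →ₗ[B] B := hb.lift ((Algebra.linearMap A B) ∘ₗ v.liftKaehlerDifferential)
  refine ⟨l.compDer (KaehlerDifferential.D k B), fun a => ?_⟩
  have := hb.lift_eq ((Algebra.linearMap A B) ∘ₗ v.liftKaehlerDifferential)
    (KaehlerDifferential.D k A a)
  simpa [l] using this

end Extension

/-! ### Clearing denominators of rational vector fields and forms -/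

section Fractions

variable {k A K : Type} [Field k] [CommRing A] [Field K] [Algebra k K] [Algebra A K]

variable (A) in
theorem Derivation.ext_of_isFractionRing [IsFractionRing A K] {w w' : Derivation k K K}
    (h : ∀ a, w (algebraMap A K a) = w' (algebraMap A K a)) : w = w' := by
  ext x
  obtain ⟨a, s, hs, rfl⟩ := IsFractionRing.div_surjective (A := A) x
  simp [Derivation.leibniz_div, h]

variable [Algebra k A] [IsScalarTower k A K]

/-- A common denominator for the values of `w` on finitely many algebra generators works on all of
`A`, by the Leibniz rule. -/
theorem Derivation.exists_smul_extends [IsFractionRing A K] [Algebra.FiniteType k A]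
    (w : Derivation k K K) :
    ∃ a ∈ nonZeroDivisors A, ∃ v : Derivation k A A, ((algebraMap A K a) • w).Extends v := by
  classical
  obtain ⟨s, hs⟩ := Algebra.FiniteType.out (R := k) (A := A)
  obtain ⟨b, hb⟩ := IsLocalization.exist_integer_multiples_of_finset (nonZeroDivisors A)
    (s.image fun x => w (algebraMap A K x))
  have key : ∀ x : A, ∃ y : A, algebraMap A K y = algebraMap A K b * w (algebraMap A K x) := by
    intro x
    have hx : x ∈ Algebra.adjoin k (s : Set A) := hs ▸ Algebra.mem_top
    induction hx using Algebra.adjoin_induction with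
    | mem x hx =>
      obtain ⟨y, hy⟩ := hb _ (Finset.mem_image_of_mem _ hx)
      exact ⟨y, by rw [hy, Algebra.smul_def]⟩
    | algebraMap r => exact ⟨0, by simp [← IsScalarTower.algebraMap_apply]⟩
    | add x y _ _ hx hy =>
      obtain ⟨x', hx⟩ := hx
      obtain ⟨y', hy⟩ := hy
      exact ⟨x' + y', by simp [hx, hy, mul_add]⟩
    | mul x y _ _ hx hy =>
      obtain ⟨x', hx⟩ := hx
      obtain ⟨y', hy⟩ := hy
      exact ⟨x * y' + y * x', by
        simp only [map_add, map_mul, hx, hy, Derivation.leibniz, smul_eq_mul]; ring⟩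
  choose v hv using key
  have hinj := IsFractionRing.injective A K
  refine ⟨b, b.2, Derivation.mk' ⟨⟨v, fun x y => hinj ?_⟩, fun c x => hinj ?_⟩ fun x y =>
    hinj ?_, fun a => (hv a).symm⟩
  · simp [hv, mul_add]
  · simp only [hv, Algebra.smul_def, map_mul, ← IsScalarTower.algebraMap_apply, RingHom.id_apply]
    rw [Derivation.leibniz, Derivation.map_algebraMap]
    simp only [smul_eq_mul]; ring
  · simp only [LinearMap.coe_mk, AddHom.coe_mk, smul_eq_mul, map_add, map_mul, hv,
      Derivation.leibniz]
    ring

variable (A) in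
theorem KaehlerDifferential.exists_smul_eq_map [IsFractionRing A K] (ω : Ω[K⁄k]) :
    ∃ a ∈ nonZeroDivisors A, ∃ α : Ω[A⁄k],
      KaehlerDifferential.map k k A K α = (algebraMap A K a) • ω := by
  obtain ⟨⟨α, s⟩, h⟩ := IsLocalizedModule.surj (nonZeroDivisors A)
    (KaehlerDifferential.map k k A K) ω
  exact ⟨s, s.2, α, by rw [← h, algebraMap_smul]; rfl⟩

end Fractions

/-! ### Differentials of function fields -/

section FieldForms

variable {k K : Type} [Field k] [Field K] [Algebra k K]

/-- Double annihilator: derivations of `K` are exactly the linear forms on `Ω[K⁄k]`, and these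
separate a subspace from any vector outside it. -/
theorem Derivation.lift_eq_zero_of_forall (N : Submodule K Ω[K⁄k]) (ω : Ω[K⁄k])
    (h : ∀ w : Derivation k K K, (∀ ν ∈ N, w.liftKaehlerDifferential ν = 0) →
      w.liftKaehlerDifferential ω = 0) : ω ∈ N := by
  by_contra hω
  obtain ⟨f, hf, hN⟩ := Submodule.exists_dual_map_eq_bot_of_notMem hω inferInstance
  let w := KaehlerDifferential.linearMapEquivDerivation k K f
  have hw : w.liftKaehlerDifferential = f :=
    (KaehlerDifferential.linearMapEquivDerivation k K).symm_apply_apply f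
  refine hf (hw ▸ h w fun ν hν => ?_)
  rw [hw]
  have : f ν ∈ Submodule.map f N := Submodule.mem_map_of_mem hν
  rwa [hN, Submodule.mem_bot] at this

/-- If `f` were transcendental, `K` would be formally smooth over `k[f]` in characteristic zero. The
vanishing of `H1Cotangent` then makes `K ⊗ Ω[k[f]⁄k] → Ω[K⁄k]` injective, while its source is free
on `1 ⊗ df`. -/
theorem KaehlerDifferential.isAlgebraic_of_D_eq_zero [CharZero k] [Algebra.EssFiniteType k K]
    {f : K} (hf : KaehlerDifferential.D k K f = 0) : IsAlgebraic k f := by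
  by_contra htr
  have htr : Transcendental k f := htr
  let : Algebra (Polynomial k) K := (Polynomial.aeval f).toAlgebra
  have haX : algebraMap (Polynomial k) K Polynomial.X = f := Polynomial.aeval_X f
  have : IsScalarTower k (Polynomial k) K :=
    IsScalarTower.of_algebraMap_eq fun c => (Polynomial.aeval_C f c).symm
  have hinj : Function.Injective (algebraMap (Polynomial k) K) :=
    transcendental_iff_injective.mp htr
  have : FaithfulSMul (Polynomial k) K := (faithfulSMul_iff_algebraMap_injective _ _).mpr hinj
  let : Algebra (FractionRing (Polynomial k)) K := FractionRing.liftAlgebra (Polynomial k) K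
  have : IsScalarTower (Polynomial k) (FractionRing (Polynomial k)) K := inferInstance
  have : IsScalarTower k (FractionRing (Polynomial k)) K :=
    IsScalarTower.of_algebraMap_eq fun c => by
      rw [IsScalarTower.algebraMap_apply k (Polynomial k) K,
        IsScalarTower.algebraMap_apply (Polynomial k) (FractionRing (Polynomial k)) K,
        ← IsScalarTower.algebraMap_apply k (Polynomial k) (FractionRing (Polynomial k))]
  have : CharZero (FractionRing (Polynomial k)) :=
    charZero_of_injective_algebraMap (algebraMap k _).injective
  have : Algebra.EssFiniteType (FractionRing (Polynomial k)) K :=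
    Algebra.EssFiniteType.of_comp k _ _
  have : Algebra.FormallySmooth (Polynomial k) (FractionRing (Polynomial k)) :=
    .of_isLocalization (nonZeroDivisors _)
  have : Algebra.FormallySmooth (Polynomial k) K := .comp _ (FractionRing (Polynomial k)) _
  have inj : Function.Injective (KaehlerDifferential.mapBaseChange k (Polynomial k) K) := by
    rw [injective_iff_map_eq_zero]
    intro x hx
    obtain ⟨x, rfl⟩ := (Algebra.H1Cotangent.exact_δ_mapBaseChange k (Polynomial k) K x).mp hx
    rw [Subsingleton.elim x 0, map_zero]
  have h1 : (1 : K) ⊗ₜ[Polynomial k] KaehlerDifferential.D k (Polynomial k) Polynomial.X = 0 := by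
    apply inj
    simp [haX, hf]
  have h2 := congrArg (LinearMap.lTensor K
    (KaehlerDifferential.polynomialEquiv k).toLinearMap) h1
  rw [map_zero, LinearMap.lTensor_tmul] at h2
  have h3 := congrArg (TensorProduct.rid (Polynomial k) K) h2
  simp at h3

theorem KaehlerDifferential.mem_range_of_D_eq_zero [CharZero k] [IsAlgClosed k]
    [Algebra.EssFiniteType k K] {f : K} (hf : KaehlerDifferential.D k K f = 0) :
    ∃ c : k, algebraMap k K c = f := by
  have h := (isAlgebraic_of_D_eq_zero hf).isIntegral
  obtain ⟨c, hc⟩ := (IsAlgClosed.algebraMap_bijective_of_isIntegral (k := k)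
    (K := integralClosure k K)).2 ⟨f, h⟩
  exact ⟨c, congrArg Subtype.val hc⟩

end FieldForms

/-! ### Affine opens and the function field; contraction -/

namespace ProjectiveManifold

variable (X : ProjectiveManifold)

instance finiteTypeSections (U : X.toScheme.affineOpens) :
    Algebra.FiniteType ℂ Γ(X.toScheme, U) := by
  have h1 := X.str.finiteType_appLE (isAffineOpen_top _) U.2 le_top
  have h2 : (Scheme.ΓSpecIso (.of ℂ)).inv.hom.FiniteType :=
    RingHom.FiniteType.of_surjective _
      (Scheme.ΓSpecIso (.of ℂ)).symm.commRingCatIsoToRingEquiv.surjective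
  exact h1.comp h2

instance isFractionRingRatFun (U : X.toScheme.affineOpens) [Nonempty U.1] :
    IsFractionRing Γ(X.toScheme, U) X.RatFun :=
  functionField_isFractionRing_of_isAffineOpen _ _ U.2

instance formallyEtaleRatFun (U : X.toScheme.affineOpens) [Nonempty U.1] :
    Algebra.FormallyEtale Γ(X.toScheme, U) X.RatFun :=
  Algebra.FormallyEtale.of_isLocalization (nonZeroDivisors Γ(X.toScheme, U))

theorem nonempty_affineOpens : ∃ U : X.toScheme.affineOpens, Nonempty U.1 := by
  obtain ⟨W, hW, hx, -⟩ := exists_isAffineOpen_mem_and_subset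
    (X := X.toScheme) (x := genericPoint X.toScheme) (U := ⊤) trivial
  exact ⟨⟨W, hW⟩, ⟨⟨_, hx⟩⟩⟩

instance essFiniteTypeRatFun : Algebra.EssFiniteType ℂ X.RatFun := by
  obtain ⟨U, hU⟩ := X.nonempty_affineOpens
  have : Algebra.EssFiniteType Γ(X.toScheme, U) X.RatFun :=
    Algebra.EssFiniteType.of_isLocalization _ (nonZeroDivisors Γ(X.toScheme, U))
  exact .comp _ Γ(X.toScheme, U) _

variable {X}

theorem algebraMap_restrict {U V : X.toScheme.Opens} [Nonempty U] [Nonempty V] (h : V ≤ U)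
    (f : Γ(X.toScheme, U)) :
    algebraMap Γ(X.toScheme, V) X.RatFun (X.restrict h f) =
      algebraMap Γ(X.toScheme, U) X.RatFun f :=
  X.toScheme.presheaf.germ_res_apply (homOfLE h) _ _ _

theorem toRatForm_restrictForm {U V : X.toScheme.Opens} [Nonempty U] [Nonempty V] (h : V ≤ U)
    (α : Ω[Γ(X.toScheme, U)⁄ℂ]) : X.toRatForm V (X.restrictForm h α) = X.toRatForm U α := by
  let _ : Algebra Γ(X.toScheme, U) Γ(X.toScheme, V) := (X.restrict h).toAlgebra
  have _ : IsScalarTower ℂ Γ(X.toScheme, U) Γ(X.toScheme, V) :=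
    IsScalarTower.of_algebraMap_eq fun c => (X.restrict_const h c).symm
  have _ : IsScalarTower Γ(X.toScheme, U) Γ(X.toScheme, V) X.RatFun :=
    IsScalarTower.of_algebraMap_eq fun f => (algebraMap_restrict h f).symm
  have : ((X.toRatForm V).restrictScalars Γ(X.toScheme, U)) ∘ₗ
      (KaehlerDifferential.map ℂ ℂ Γ(X.toScheme, U) Γ(X.toScheme, V)) = X.toRatForm U := by
    apply Derivation.liftKaehlerDifferential_unique
    ext f
    simp [toRatForm, ← IsScalarTower.algebraMap_apply]
  exact LinearMap.congr_fun this α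

theorem exists_restrict_derivation (U : X.toScheme.affineOpens) (f : Γ(X.toScheme, U))
    (v : Derivation ℂ Γ(X.toScheme, U) Γ(X.toScheme, U)) :
    ∃ w : Derivation ℂ Γ(X.toScheme, X.toScheme.basicOpen f) Γ(X.toScheme, X.toScheme.basicOpen f),
      ∀ g, w (X.restrict (X.toScheme.basicOpen_le f) g) =
        X.restrict (X.toScheme.basicOpen_le f) (v g) := by
  have _ : IsScalarTower ℂ Γ(X.toScheme, U) Γ(X.toScheme, X.toScheme.basicOpen f) :=
    IsScalarTower.of_algebraMap_eq fun c => (X.restrict_const _ c).symm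
  have := U.2.isLocalization_basicOpen f
  have : Algebra.FormallyEtale Γ(X.toScheme, U) Γ(X.toScheme, X.toScheme.basicOpen f) :=
    Algebra.FormallyEtale.of_isLocalization (Submonoid.powers f)
  exact v.exists_extends

theorem nonempty_inf (U V : X.toScheme.Opens) [hU : Nonempty U] [hV : Nonempty V] :
    Nonempty (U ⊓ V : X.toScheme.Opens) := by
  obtain ⟨x, hx⟩ := nonempty_preirreducible_inter U.2 V.2
    (by simpa using hU) (by simpa using hV)
  exact ⟨⟨x, hx⟩⟩

/-- `W` is a basic open of `U`, because localization is formally étale and so every vector field on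
`U` restricts to it. -/
theorem exists_affine_le_inf (U V : X.toScheme.affineOpens) [Nonempty U.1] [Nonempty V.1] :
    ∃ (W : X.toScheme.affineOpens) (hU : W.1 ≤ U.1), W.1 ≤ V.1 ∧ Nonempty W.1 ∧
      ∀ v : Derivation ℂ Γ(X.toScheme, U) Γ(X.toScheme, U),
        ∃ w : Derivation ℂ Γ(X.toScheme, W) Γ(X.toScheme, W),
          ∀ g, w (X.restrict hU g) = X.restrict hU (v g) := by
  obtain ⟨⟨x, hx⟩⟩ := nonempty_inf U.1 V.1
  obtain ⟨f, g, h, hf⟩ := exists_basicOpen_le_affine_inter U.2 V.2 x hx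
  exact ⟨X.toScheme.affineBasicOpen f, X.toScheme.basicOpen_le f,
    h.trans_le (X.toScheme.basicOpen_le g), ⟨⟨x, hf⟩⟩, exists_restrict_derivation U f⟩

theorem contract_add_left (ω ω' : X.RatForm) (v : X.RatVectorField) :
    contract (ω + ω') v = contract ω v + contract ω' v := map_add _ _ _

theorem contract_smul_left (a : X.RatFun) (ω : X.RatForm) (v : X.RatVectorField) :
    contract (a • ω) v = a * contract ω v := map_smul v.liftKaehlerDifferential a ω

@[simp]
theorem contract_zero_left (v : X.RatVectorField) : contract (0 : X.RatForm) v = 0 := map_zero _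

/-- Contraction with a rational `1`-form, as a linear map. -/
noncomputable def contractLin (ω : X.RatForm) : X.RatVectorField →ₗ[X.RatFun] X.RatFun :=
  (LinearMap.applyₗ ω) ∘ₗ (KaehlerDifferential.linearMapEquivDerivation ℂ X.RatFun).symm.toLinearMap

theorem contractLin_apply (ω : X.RatForm) (v : X.RatVectorField) :
    contractLin ω v = contract ω v := rfl

theorem contract_add (ω : X.RatForm) (v w : X.RatVectorField) :
    contract ω (v + w) = contract ω v + contract ω w := map_add (contractLin ω) v w

theorem contract_sub (ω : X.RatForm) (v w : X.RatVectorField) :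
    contract ω (v - w) = contract ω v - contract ω w := map_sub (contractLin ω) v w

theorem contract_smul (ω : X.RatForm) (a : X.RatFun) (v : X.RatVectorField) :
    contract ω (a • v) = a * contract ω v := map_smul (contractLin ω) a v

theorem contract_sum (ω : X.RatForm) {ι : Type*} (s : Finset ι) (v : ι → X.RatVectorField) :
    contract ω (∑ i ∈ s, v i) = ∑ i ∈ s, contract ω (v i) := map_sum (contractLin ω) v s

theorem contract_sum_left {ι : Type*} (s : Finset ι) (ω : ι → X.RatForm) (v : X.RatVectorField) :
    contract (∑ i ∈ s, ω i) v = ∑ i ∈ s, contract (ω i) v := map_sum v.liftKaehlerDifferential ω s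

theorem contract_D (f : X.RatFun) (v : X.RatVectorField) :
    contract (KaehlerDifferential.D ℂ X.RatFun f) v = v f :=
  v.liftKaehlerDifferential_comp_D f

theorem contract_toRatForm {U : X.toScheme.Opens} [Nonempty U] {w : X.RatVectorField}
    {v : Derivation ℂ Γ(X.toScheme, U) Γ(X.toScheme, U)} (h : w.Extends v)
    (α : Ω[Γ(X.toScheme, U)⁄ℂ]) :
    contract (X.toRatForm U α) w = algebraMap _ X.RatFun (v.liftKaehlerDifferential α) :=
  h.lift_map α

theorem commutator_smul_smul (a b : X.RatFun) (v w : X.RatVectorField) :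
    ⁅a • v, b • w⁆ = (a * b) • ⁅v, w⁆ + (a * v b) • w - (b * w a) • v := by
  ext f
  simp [Derivation.commutator_apply]
  ring

/-! ### A foliation and its rational conormal and tangent spaces -/

namespace Foliation

variable (F G : X.Foliation)

theorem toRatForm_mem_ratConormal (U : X.toScheme.affineOpens) [Nonempty U.1]
    {α : Ω[Γ(X.toScheme, U)⁄ℂ]} (h : α ∈ F.conormal U) : X.toRatForm U.1 α ∈ F.ratConormal :=
  Submodule.subset_span ⟨U, ‹_›, α, h, rfl⟩

theorem extends_mem_ratTangent (U : X.toScheme.affineOpens) [Nonempty U.1]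
    {v : Derivation ℂ Γ(X.toScheme, U) Γ(X.toScheme, U)} (h : v ∈ F.tangent U)
    {w : X.RatVectorField} (hw : w.Extends v) : w ∈ F.ratTangent :=
  Submodule.subset_span ⟨U, ‹_›, v, h, hw⟩

variable {F} in
-- The field and the form may come from different affine opens. Both generators are restricted to a
-- common smaller one, where tangent and conormal sections annihilate each other.
theorem contract_eq_zero {v : X.RatVectorField} (hv : v ∈ F.ratTangent) {ω : X.RatForm}
    (hω : ω ∈ F.ratConormal) : contract ω v = 0 := by
  induction hω using Submodule.span_induction with
  | zero => simp
  | add _ _ _ _ h1 h2 => rw [contract_add_left, h1, h2, add_zero]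
  | smul a _ _ h => rw [contract_smul_left, h, mul_zero]
  | mem ω hω =>
    obtain ⟨V, hV, β, hβ, rfl⟩ := hω
    suffices F.ratTangent ≤ LinearMap.ker (contractLin (X.toRatForm V.1 β)) from this hv
    refine Submodule.span_le.mpr ?_
    rintro v ⟨U, hU, w, hw, hvw⟩
    obtain ⟨W, hWU, hWV, hW, hres⟩ := exists_affine_le_inf U V
    obtain ⟨w', hw'⟩ := hres w
    have hwW : w' ∈ F.tangent W := F.tangent_restrict U W hWU w hw w' hw'
    obtain ⟨v', hv'⟩ := w'.exists_extends (B := X.RatFun)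
    have hvv : v = v' := by
      refine Derivation.ext_of_isFractionRing Γ(X.toScheme, U) fun a => ?_
      have h1 := hv' (X.restrict hWU a)
      rw [hw', algebraMap_restrict, algebraMap_restrict] at h1
      rw [hvw, h1]
    have hzero := (F.mem_tangent_iff W w').mp hwW _ (F.conormal_restrict V W hWV β hβ)
    have h2 := contract_toRatForm hv' (X.restrictForm hWV β)
    rw [toRatForm_restrictForm] at h2
    rw [SetLike.mem_coe, LinearMap.mem_ker, contractLin_apply, hvv, h2, hzero, map_zero]

theorem exists_smul_extends_mem_tangent (U : X.toScheme.affineOpens) [Nonempty U.1]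
    {w : X.RatVectorField} (hw : ∀ ω ∈ F.ratConormal, contract ω w = 0) :
    ∃ a ∈ nonZeroDivisors Γ(X.toScheme, U), ∃ v ∈ F.tangent U,
      (algebraMap Γ(X.toScheme, U) X.RatFun a • w).Extends v := by
  obtain ⟨a, ha, v, hv⟩ := w.exists_smul_extends (A := Γ(X.toScheme, U))
  refine ⟨a, ha, v, (F.mem_tangent_iff U v).mpr fun ω hω => ?_, hv⟩
  apply IsFractionRing.injective Γ(X.toScheme, U) X.RatFun
  rw [map_zero, ← contract_toRatForm hv, contract_smul, hw _ (F.toRatForm_mem_ratConormal U hω),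
    mul_zero]

theorem mem_ratTangent_iff {v : X.RatVectorField} :
    v ∈ F.ratTangent ↔ ∀ ω ∈ F.ratConormal, contract ω v = 0 := by
  refine ⟨fun h ω hω => contract_eq_zero h hω, fun h => ?_⟩
  obtain ⟨U, hU⟩ := X.nonempty_affineOpens
  obtain ⟨a, ha, w, hw, hext⟩ := F.exists_smul_extends_mem_tangent U h
  have := F.extends_mem_ratTangent U hw hext
  rwa [Submodule.smul_mem_iff _
    (IsFractionRing.to_map_ne_zero_of_mem_nonZeroDivisors ha)] at this

theorem mem_ratConormal_iff {ω : X.RatForm} :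
    ω ∈ F.ratConormal ↔ ∀ v ∈ F.ratTangent, contract ω v = 0 :=
  ⟨fun h _ hv => contract_eq_zero hv h, fun h => Derivation.lift_eq_zero_of_forall _ _
    fun w hw => h w (F.mem_ratTangent_iff.mpr hw)⟩

/-- The conormal sheaf is saturated, being an annihilator, so membership can be tested generically.
-/
theorem mem_conormal_iff_toRatForm (U : X.toScheme.affineOpens) [Nonempty U.1]
    {α : Ω[Γ(X.toScheme, U)⁄ℂ]} : α ∈ F.conormal U ↔ X.toRatForm U.1 α ∈ F.ratConormal := by
  refine ⟨F.toRatForm_mem_ratConormal U, fun h => (F.mem_conormal_iff U α).mpr fun v hv => ?_⟩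
  obtain ⟨w, hw⟩ := v.exists_extends (B := X.RatFun)
  apply IsFractionRing.injective Γ(X.toScheme, U) X.RatFun
  rw [map_zero, ← contract_toRatForm hw]
  exact contract_eq_zero (F.extends_mem_ratTangent U hv hw) h

variable {F G}

theorem subsingleton_sections (U : X.toScheme.affineOpens) (hU : ¬ Nonempty U.1) :
    Subsingleton Γ(X.toScheme, U) := by
  have : U.1 = ⊥ := by
    ext x
    simp only [TopologicalSpace.Opens.coe_bot, Set.mem_empty_iff_false, iff_false]
    exact fun hx => hU ⟨⟨x, hx⟩⟩
  rw [this]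
  infer_instance

theorem contains_iff : F.Contains G ↔ F.ratConormal ≤ G.ratConormal := by
  constructor
  · intro h ω hω
    rw [mem_ratConormal_iff] at hω ⊢
    refine fun v hv => hω v (Submodule.span_mono ?_ hv)
    rintro v ⟨U, hU, w, hw, hvw⟩
    exact ⟨U, hU, w, h U hw, hvw⟩
  · intro h U v hv
    rw [mem_tangent_iff] at hv ⊢
    intro ω hω
    by_cases hU : Nonempty U.1
    · exact hv ω ((G.mem_conormal_iff_toRatForm U).mpr (h (F.toRatForm_mem_ratConormal U hω)))
    · have := subsingleton_sections U hU
      exact Subsingleton.elim _ _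

theorem ext_ratConormal (h : F.ratConormal = G.ratConormal) : F = G := by
  have hc : F.conormal = G.conormal := by
    ext U α
    by_cases hU : Nonempty U.1
    · rw [mem_conormal_iff_toRatForm, mem_conormal_iff_toRatForm, h]
    · have := subsingleton_sections U hU
      have : Subsingleton Ω[Γ(X.toScheme, U)⁄ℂ] := Module.subsingleton Γ(X.toScheme, U) _
      rw [Subsingleton.elim α 0]
      simp only [zero_mem]
  refine Foliation.ext (funext fun U => Submodule.ext fun v => ?_) hc
  rw [mem_tangent_iff, mem_tangent_iff, hc]

/-- After denominators are cleared the bracket is one of regular sections, and the Leibniz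
corrections are multiples of `v` and `w` themselves. -/
theorem commutator_mem_ratTangent {v w : X.RatVectorField} (hv : v ∈ F.ratTangent)
    (hw : w ∈ F.ratTangent) : ⁅v, w⁆ ∈ F.ratTangent := by
  obtain ⟨U, hU⟩ := X.nonempty_affineOpens
  obtain ⟨a, ha, v', hv', hva⟩ := F.exists_smul_extends_mem_tangent U (F.mem_ratTangent_iff.mp hv)
  obtain ⟨b, hb, w', hw', hwb⟩ := F.exists_smul_extends_mem_tangent U (F.mem_ratTangent_iff.mp hw)
  have h := F.extends_mem_ratTangent U (F.involutive U v' hv' w' hw')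
    (w := ⁅algebraMap _ X.RatFun a • v, algebraMap _ X.RatFun b • w⁆) fun f => by
      rw [Derivation.commutator_apply, hwb, hva, hva, hwb, Derivation.commutator_apply, map_sub]
  rw [commutator_smul_smul] at h
  have h1 := sub_mem (add_mem h
      (Submodule.smul_mem _ (algebraMap _ X.RatFun b * w (algebraMap _ X.RatFun a)) hv))
    (Submodule.smul_mem _ (algebraMap _ X.RatFun a * v (algebraMap _ X.RatFun b)) hw)
  have h2 : (algebraMap _ X.RatFun a * algebraMap _ X.RatFun b) • ⁅v, w⁆ ∈ F.ratTangent := by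
    convert h1 using 1
    abel
  rwa [Submodule.smul_mem_iff] at h2
  exact mul_ne_zero (IsFractionRing.to_map_ne_zero_of_mem_nonZeroDivisors ha)
    (IsFractionRing.to_map_ne_zero_of_mem_nonZeroDivisors hb)

end Foliation

/-! ### Exterior derivative and wedge product on rational vector fields -/

theorem contract_neg (ω : X.RatForm) (v : X.RatVectorField) :
    contract ω (-v) = -contract ω v := map_neg (contractLin ω) v

theorem smul_commutator (a : X.RatFun) (v w : X.RatVectorField) :
    ⁅a • v, w⁆ = a • ⁅v, w⁆ - (w a) • v := by
  ext f
  simp [Derivation.commutator_apply]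
  ring

/-- Rational `1`-forms are a finite-dimensional space whose dual is the space of vector fields, so
reflexivity turns linear functions of fields into forms. -/
theorem exists_contract_eq (L : X.RatVectorField →ₗ[X.RatFun] X.RatFun) :
    ∃ α : X.RatForm, ∀ v, contract α v = L v := by
  let e := KaehlerDifferential.linearMapEquivDerivation ℂ X.RatFun (M := X.RatFun)
  obtain ⟨α, hα⟩ := (Module.evalEquiv X.RatFun X.RatForm).surjective (L ∘ₗ e.toLinearMap)
  refine ⟨α, fun v => (LinearMap.congr_fun hα (e.symm v)).trans ?_⟩
  simp

theorem exteriorDerivative_neg_swap (ω : X.RatForm) (v w : X.RatVectorField) :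
    exteriorDerivative ω v w = -exteriorDerivative ω w v := by
  simp only [exteriorDerivative]
  rw [← lie_skew v w, contract_neg]
  ring

theorem exteriorDerivative_add_left (ω : X.RatForm) (u v w : X.RatVectorField) :
    exteriorDerivative ω (u + v) w = exteriorDerivative ω u w + exteriorDerivative ω v w := by
  simp only [exteriorDerivative, contract_add, add_lie, map_add, Derivation.add_apply]
  ring

theorem exteriorDerivative_smul_left (ω : X.RatForm) (a : X.RatFun) (v w : X.RatVectorField) :
    exteriorDerivative ω (a • v) w = a * exteriorDerivative ω v w := by
  simp only [exteriorDerivative, contract_smul, smul_commutator, contract_sub,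
    Derivation.leibniz, Derivation.smul_apply, smul_eq_mul]
  ring

/-- `v ↦ dω(v, w)` as a linear map. -/
noncomputable def exteriorDerivativeLin (ω : X.RatForm) (w : X.RatVectorField) :
    X.RatVectorField →ₗ[X.RatFun] X.RatFun where
  toFun v := exteriorDerivative ω v w
  map_add' u v := exteriorDerivative_add_left ω u v w
  map_smul' a v := exteriorDerivative_smul_left ω a v w

/-- `v ↦ (θ ∧ ω)(v, w)` as a linear map. -/
noncomputable def wedgeLin (θ ω : X.RatForm) (w : X.RatVectorField) :
    X.RatVectorField →ₗ[X.RatFun] X.RatFun :=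
  contract ω w • contractLin θ - contract θ w • contractLin ω

theorem wedgeLin_apply (θ ω : X.RatForm) (v w : X.RatVectorField) :
    wedgeLin θ ω w v = wedge θ ω v w := by
  simp [wedgeLin, wedge, contractLin_apply, mul_comm]

theorem wedge_neg_swap (θ ω : X.RatForm) (v w : X.RatVectorField) :
    wedge θ ω v w = -wedge θ ω w v := by
  simp only [wedge]; ring

/-- If `dω = θ ∧ ω` then `dθ ∧ ω = 0`. -/
theorem exteriorDerivative_cyclic {ω θ : X.RatForm} (h : exteriorDerivative ω = wedge θ ω)
    (u v w : X.RatVectorField) :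
    exteriorDerivative θ v w * contract ω u + exteriorDerivative θ w u * contract ω v +
      exteriorDerivative θ u v * contract ω w = 0 := by
  have H : ∀ x y : X.RatVectorField, x (contract ω y) - y (contract ω x) - contract ω ⁅x, y⁆ =
      contract θ x * contract ω y - contract θ y * contract ω x :=
    fun x y => congrFun (congrFun h x) y
  -- The hypothesis differentiated along a third field. The cyclic sum, with the Jacobi identity
  -- `J`, is `d(dω) = 0` written out.
  have D : ∀ x y z : X.RatVectorField, z (x (contract ω y)) - z (y (contract ω x)) -
      z (contract ω ⁅x, y⁆) = z (contract θ x) * contract ω y + contract θ x * z (contract ω y) -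
        z (contract θ y) * contract ω x - contract θ y * z (contract ω x) := by
    intro x y z
    have := congrArg z (H x y)
    simp only [map_sub, Derivation.leibniz, smul_eq_mul] at this
    linear_combination this
  have J : contract ω ⁅u, ⁅v, w⁆⁆ + contract ω ⁅v, ⁅w, u⁆⁆ + contract ω ⁅w, ⁅u, v⁆⁆ = 0 := by
    rw [← contract_add, ← contract_add, lie_jacobi]
    exact map_zero (contractLin ω)
  have h1 := D v w u
  have h2 := D w u v
  have h3 := D u v w
  have k1 := H u ⁅v, w⁆
  have k2 := H v ⁅w, u⁆
  have k3 := H w ⁅u, v⁆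
  simp only [Derivation.commutator_apply] at k1 k2 k3
  simp only [exteriorDerivative]
  linear_combination -h1 - h2 - h3 - k1 - k2 - k3 - J + contract θ u * H v w +
    contract θ v * H w u + contract θ w * H u v

theorem _root_.Fin.exists_ne_of_two_lt {q : ℕ} (hq : 2 < q) (j k : Fin q) :
    ∃ i, i ≠ j ∧ i ≠ k := by
  obtain ⟨i, -, hi⟩ := Finset.exists_mem_notMem_of_card_lt_card
    (s := ({j, k} : Finset (Fin q))) (t := Finset.univ)
    (Finset.card_le_two.trans_lt (by simpa using hq))
  exact ⟨i, by simpa using hi⟩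

/-! ### Eigenforms, dual frames and the closed connection form -/

namespace Foliation

variable {G : X.Foliation} {η : G.RatLeafForm}

theorem bott_apply {ω : X.RatForm} (hω : ω ∈ G.eigenspace η) {v : X.RatVectorField}
    (hv : v ∈ G.ratTangent) (ξ : X.RatVectorField) :
    contract ω ⁅v, ξ⁆ = v (contract ω ξ) - η ⟨v, hv⟩ * contract ω ξ := by
  linear_combination -hω.2 ⟨v, hv⟩ ξ

/-- Otherwise `c⁻¹` would have logarithmic derivative `η` along `G`. All uses of the hypothesis on
`η` go through this rigidity. -/
theorem eq_zero_of_apply_eq_neg (hη : ¬ G.IsLogExact η) {c : X.RatFun}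
    (hc : ∀ v : G.ratTangent, v.1 c = -(η v * c)) : c = 0 := by
  by_contra h
  refine hη ⟨c⁻¹, inv_ne_zero h, fun v => ?_⟩
  rw [Derivation.leibniz_inv, hc, smul_eq_mul]
  field_simp

variable (G η) in
/-- A family of eigenforms which is a basis of the rational conormal space, together with a dual
family of rational vector fields. -/
structure EigenFrame (q : ℕ) where
  form : Fin q → X.RatForm
  field : Fin q → X.RatVectorField
  form_mem : ∀ i, form i ∈ G.eigenspace η
  span_form : Submodule.span X.RatFun (Set.range form) = G.ratConormal
  contract_field : ∀ i j, contract (form i) (field j) = if i = j then 1 else 0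

theorem exists_eigenFrame {q : ℕ} (hcodim : G.codim = q) (hgen : G.IsGeneratedByEigenspace η) :
    Nonempty (EigenFrame G η q) := by
  obtain ⟨w, hw, hspan, hli⟩ := Submodule.exists_fun_fin_finrank_span_eq X.RatFun
    (G.eigenspace η : Set X.RatForm)
  have hspan' := hspan.trans hgen
  have hfin : Module.finrank X.RatFun
      (Submodule.span X.RatFun (G.eigenspace η : Set X.RatForm)) = q := by
    rw [show Submodule.span X.RatFun (G.eigenspace η : Set X.RatForm) = _ from hgen]
    exact hcodim
  -- The family is generalized so that its index type `Fin (finrank …)` can be rewritten to `Fin q`.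
  revert w
  rw [hfin]
  intro w hw hspan hli hspan'
  have key : ∀ j : Fin q, ∃ ξ : X.RatVectorField, ∀ i,
      contract (w i) ξ = if i = j then 1 else 0 := by
    intro j
    obtain ⟨f, hf⟩ := LinearMap.exists_extend ((Module.Basis.span hli).coord j)
    let ξ := KaehlerDifferential.linearMapEquivDerivation ℂ X.RatFun f
    have hξ : ξ.liftKaehlerDifferential = f :=
      (KaehlerDifferential.linearMapEquivDerivation ℂ X.RatFun).symm_apply_apply f
    refine ⟨ξ, fun i => ?_⟩
    have h := LinearMap.congr_fun hf (Module.Basis.span hli i)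
    rw [Module.Basis.coord_apply, Module.Basis.repr_self, Finsupp.single_apply] at h
    rw [contract, hξ, ← h, LinearMap.comp_apply, Submodule.subtype_apply,
      Module.Basis.span_apply]
  choose ξ hξ using key
  exact ⟨⟨w, ξ, hw, hspan', fun i j => hξ j i⟩⟩

namespace EigenFrame

variable {q : ℕ} (B : EigenFrame G η q)

theorem contract_sum_form (f : Fin q → X.RatFun) (j : Fin q) :
    contract (∑ i, f i • B.form i) (B.field j) = f j := by
  simp [contract_sum_left, contract_smul_left, B.contract_field]

theorem sum_contract_smul_form {ω : X.RatForm} (hω : ω ∈ G.ratConormal) :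
    ∑ i, contract ω (B.field i) • B.form i = ω := by
  rw [← B.span_form] at hω
  obtain ⟨c, rfl⟩ := (Submodule.mem_span_range_iff_exists_fun _).mp hω
  simp only [B.contract_sum_form]

theorem form_mem_ratConormal (i : Fin q) : B.form i ∈ G.ratConormal := (B.form_mem i).1

theorem contract_form_commutator {v : X.RatVectorField} (hv : v ∈ G.ratTangent) (i j : Fin q) :
    contract (B.form i) ⁅v, B.field j⁆ = -(η ⟨v, hv⟩ * if i = j then 1 else 0) := by
  rw [bott_apply (B.form_mem i) hv, B.contract_field]
  split_ifs <;> simp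

/-- The components of a form `ω` with `∇_v ω = b ω`. -/
theorem apply_contract_field {ω : X.RatForm} (hω : ω ∈ G.ratConormal) {v : X.RatVectorField}
    (hv : v ∈ G.ratTangent) {b : X.RatFun}
    (h : ∀ ξ, v (contract ω ξ) - contract ω ⁅v, ξ⁆ = b * contract ω ξ) (j : Fin q) :
    v (contract ω (B.field j)) = (b - η ⟨v, hv⟩) * contract ω (B.field j) := by
  have h1 := h (B.field j)
  have h2 : contract ω ⁅v, B.field j⁆ = -(η ⟨v, hv⟩ * contract ω (B.field j)) := by
    conv_lhs => rw [← B.sum_contract_smul_form hω]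
    simp only [contract_sum_left, contract_smul_left, B.contract_form_commutator hv]
    simp [mul_comm]
  linear_combination h1 + h2

/-- `df` is conormal and `∇ df = 0`, so its components satisfy `v(c) = -η(v) c` and vanish. Then `df
= 0`, and `ℂ` is algebraically closed in `ℂ(X)`. -/
theorem mem_range_of_mem_firstIntegrals (B : EigenFrame G η q) (hη : ¬ G.IsLogExact η)
    {f : X.RatFun} (hf : f ∈ G.firstIntegrals) : ∃ c : ℂ, algebraMap ℂ X.RatFun c = f := by
  have hf' : ∀ v ∈ G.ratTangent, v f = 0 := hf
  apply KaehlerDifferential.mem_range_of_D_eq_zero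
  have hω : KaehlerDifferential.D ℂ X.RatFun f ∈ G.ratConormal := by
    rw [mem_ratConormal_iff]
    intro v hv
    rw [contract_D, hf' v hv]
  rw [← B.sum_contract_smul_form hω]
  refine Finset.sum_eq_zero fun i _ => ?_
  rw [eq_zero_of_apply_eq_neg hη (c := contract _ (B.field i)), zero_smul]
  rintro ⟨v, hv⟩
  rw [B.apply_contract_field hω hv (b := 0)]
  · ring
  · intro ξ
    simp only [contract_D, Derivation.commutator_apply, hf' v hv, map_zero]
    ring

theorem firstIntegrals_eq_bot (B : EigenFrame G η q) (hη : ¬ G.IsLogExact η) :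
    G.firstIntegrals = ⊥ :=
  le_bot_iff.mp fun _ hf => IntermediateField.mem_bot.mpr
    (B.mem_range_of_mem_firstIntegrals hη hf)

variable (G η) in
/-- A vector field on which all eigenforms take values in the field of first integrals. -/
def _root_.ProjectiveManifold.Foliation.IsBasic (ξ : X.RatVectorField) : Prop :=
  ∀ ω ∈ G.eigenspace η, ∀ v ∈ G.ratTangent, v (contract ω ξ) = 0

/-- For an eigenform the factor `b - η(v)` governing its components is zero. -/
theorem isBasic_field (j : Fin q) : IsBasic G η (B.field j) := by
  intro ω hω v hv
  rw [B.apply_contract_field hω.1 hv (fun ξ => hω.2 ⟨v, hv⟩ ξ) j, sub_self, zero_mul]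

end EigenFrame

theorem IsBasic.sub {ξ ξ' : X.RatVectorField} (h : IsBasic G η ξ) (h' : IsBasic G η ξ') :
    IsBasic G η (ξ - ξ') := fun ω hω v hv => by
  rw [contract_sub, map_sub, h ω hω v hv, h' ω hω v hv, sub_zero]

/-- On the normal sheaf, Bott's connection acts on a basic field by `-η`. This may be tested on
eigenforms, because they generate. -/
theorem IsBasic.commutator_add_smul_mem (hgen : G.IsGeneratedByEigenspace η)
    {ξ : X.RatVectorField} (h : IsBasic G η ξ) {v : X.RatVectorField} (hv : v ∈ G.ratTangent) :
    ⁅v, ξ⁆ + η ⟨v, hv⟩ • ξ ∈ G.ratTangent := by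
  rw [mem_ratTangent_iff]
  intro ω hω
  rw [← show Submodule.span X.RatFun (G.eigenspace η : Set X.RatForm) = _ from hgen] at hω
  induction hω using Submodule.span_induction with
  | zero => simp
  | add _ _ _ _ h1 h2 => rw [contract_add_left, h1, h2, add_zero]
  | smul a _ _ h => rw [contract_smul_left, h, mul_zero]
  | mem ω hω =>
    rw [contract_add, contract_smul, bott_apply hω hv, h ω hω v hv]
    ring

/-- Write `[v, ξ] = t - η(v) ξ` with `t` tangent to `G`. The `t` term dies because `ω(ξ') = 0`, and
the derivative of `η(v)` only multiplies `ω(ξ) = 0`. -/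
theorem IsBasic.contract_commutator_commutator (hgen : G.IsGeneratedByEigenspace η)
    {ξ ξ' : X.RatVectorField} (h : IsBasic G η ξ) {ω : X.RatForm} (hω : ω ∈ G.eigenspace η)
    (hξ : contract ω ξ = 0) (hξ' : contract ω ξ' = 0) {v : X.RatVectorField}
    (hv : v ∈ G.ratTangent) :
    contract ω ⁅⁅v, ξ⁆, ξ'⁆ = -(η ⟨v, hv⟩ * contract ω ⁅ξ, ξ'⁆) := by
  have ht := h.commutator_add_smul_mem hgen hv
  set t := ⁅v, ξ⁆ + η ⟨v, hv⟩ • ξ with htdef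
  have : ⁅v, ξ⁆ = t - η ⟨v, hv⟩ • ξ := by rw [htdef]; abel
  rw [this, sub_lie, contract_sub, bott_apply hω ht, smul_commutator, contract_sub,
    contract_smul, contract_smul, hξ, hξ']
  simp

/-- Put `c = ω([ξ, ξ'])`. By Jacobi `ω([v, [ξ, ξ']]) = -2 η(v) c`, whereas the eigenform equation
gives `v(c) - η(v) c`. Hence `v(c) = -η(v) c`. -/
theorem contract_commutator_eq_zero (hη : ¬ G.IsLogExact η) (hgen : G.IsGeneratedByEigenspace η)
    {ξ ξ' : X.RatVectorField} (h : IsBasic G η ξ) (h' : IsBasic G η ξ') {ω : X.RatForm}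
    (hω : ω ∈ G.eigenspace η) (hξ : contract ω ξ = 0) (hξ' : contract ω ξ' = 0) :
    contract ω ⁅ξ, ξ'⁆ = 0 := by
  apply eq_zero_of_apply_eq_neg hη
  rintro ⟨v, hv⟩
  have h1 := bott_apply hω hv ⁅ξ, ξ'⁆
  have h2 := h.contract_commutator_commutator hgen hω hξ hξ' hv
  have h3 := h'.contract_commutator_commutator hgen hω hξ' hξ hv
  rw [leibniz_lie, ← lie_skew ξ ⁅v, ξ'⁆, contract_add, contract_neg, h2, h3, ← lie_skew ξ' ξ,
    contract_neg] at h1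
  linear_combination -h1

namespace EigenFrame

variable {q : ℕ} (B : EigenFrame G η q)

/-- The projection of vector fields to the tangent space of `G` along the frame. -/
noncomputable def proj : X.RatVectorField →ₗ[X.RatFun] G.ratTangent :=
  LinearMap.codRestrict _
    (LinearMap.id - ∑ j, (contractLin (B.form j)).smulRight (B.field j)) fun v => by
    rw [mem_ratTangent_iff]
    intro ω hω
    rw [← B.span_form] at hω
    induction hω using Submodule.span_induction with
    | zero => simp
    | add _ _ _ _ h1 h2 => rw [contract_add_left, h1, h2, add_zero]
    | smul a _ _ h => rw [contract_smul_left, h, mul_zero]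
    | mem ω hω =>
      obtain ⟨i, rfl⟩ := hω
      simp [contract_sub, contract_sum, contract_smul, contractLin_apply, B.contract_field]

theorem proj_apply (v : X.RatVectorField) :
    (B.proj v : X.RatVectorField) = v - ∑ j, contract (B.form j) v • B.field j := by
  simp [proj, contractLin_apply]

theorem proj_of_mem {v : X.RatVectorField} (hv : v ∈ G.ratTangent) : B.proj v = ⟨v, hv⟩ :=
  Subtype.ext <| by
    rw [B.proj_apply]
    simp [contract_eq_zero hv (B.form_mem_ratConormal _)]

theorem proj_field (j : Fin q) : B.proj (B.field j) = 0 :=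
  Subtype.ext <| by
    rw [B.proj_apply]
    simp [B.contract_field]

theorem span_ratTangent_union_range :
    Submodule.span X.RatFun ((G.ratTangent : Set X.RatVectorField) ∪ Set.range B.field) = ⊤ := by
  refine eq_top_iff.mpr fun v _ => ?_
  have h : v = B.proj v + ∑ j, contract (B.form j) v • B.field j := by
    rw [B.proj_apply]; abel
  rw [h]
  exact add_mem (Submodule.subset_span (Or.inl (B.proj v).2))
    (sum_mem fun j _ => Submodule.smul_mem _ _ (Submodule.subset_span (Or.inr ⟨j, rfl⟩)))

/-- An alternating form on vector fields vanishes if it vanishes on the tangent fields of `G` and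
the frame. -/
theorem eq_zero_of_forall
    (Ψ : X.RatVectorField → X.RatVectorField →ₗ[X.RatFun] X.RatFun)
    (hskew : ∀ u v, Ψ u v = -Ψ v u)
    (h : ∀ u ∈ (G.ratTangent : Set X.RatVectorField) ∪ Set.range B.field,
      ∀ v ∈ (G.ratTangent : Set X.RatVectorField) ∪ Set.range B.field, Ψ u v = 0)
    (u v : X.RatVectorField) : Ψ u v = 0 := by
  have h1 : ∀ u ∈ (G.ratTangent : Set X.RatVectorField) ∪ Set.range B.field, Ψ u = 0 :=
    fun u hu => LinearMap.ext_on B.span_ratTangent_union_range (h u hu)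
  have h2 : ∀ u, Ψ u = 0 := fun u => LinearMap.ext_on B.span_ratTangent_union_range
    fun v hv => by rw [hskew, h1 v hv]; simp
  rw [h2, LinearMap.zero_apply]

theorem contract_commutator_field_ne (hη : ¬ G.IsLogExact η) (hgen : G.IsGeneratedByEigenspace η)
    {i j k : Fin q} (hj : i ≠ j) (hk : i ≠ k) :
    contract (B.form i) ⁅B.field j, B.field k⁆ = 0 :=
  contract_commutator_eq_zero hη hgen (B.isBasic_field j) (B.isBasic_field k) (B.form_mem i)
    (by simp [B.contract_field, hj]) (by simp [B.contract_field, hk])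

/-- The eigenform `ωᵢ + ωᵢ'` kills both `ξⱼ` and `ξᵢ - ξᵢ'`, hence their bracket; the cross terms
vanish already. So the value depends on `j` only, which is what lets one `α` serve all forms. -/
theorem contract_commutator_field_eq (hη : ¬ G.IsLogExact η)
    (hgen : G.IsGeneratedByEigenspace η) {i i' j : Fin q} (hi : i ≠ j) (hi' : i' ≠ j) :
    contract (B.form i) ⁅B.field j, B.field i⁆ = contract (B.form i') ⁅B.field j, B.field i'⁆ := by
  rcases eq_or_ne i i' with rfl | hne
  · rfl
  have h := contract_commutator_eq_zero hη hgen (B.isBasic_field j)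
    ((B.isBasic_field i).sub (B.isBasic_field i')) (add_mem (B.form_mem i) (B.form_mem i'))
    (by simp [contract_add_left, B.contract_field, hi, hi'])
    (by simp [contract_add_left, contract_sub, B.contract_field, hne, hne.symm])
  rw [lie_sub, contract_sub, contract_add_left, contract_add_left,
    B.contract_commutator_field_ne hη hgen hi hne,
    B.contract_commutator_field_ne hη hgen hi' hne.symm] at h
  linear_combination h

/-- There is a rational `1`-form `α` with `dω = α ∧ ω` for all forms `ω` of the frame. -/
theorem exists_connection_form (hq : 2 < q) (hη : ¬ G.IsLogExact η)
    (hgen : G.IsGeneratedByEigenspace η) :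
    ∃ α : X.RatForm, ∀ i, exteriorDerivative (B.form i) = wedge α (B.form i) := by
  -- `s j` is any index different from `j`. The value `α(ξⱼ) = -ω_{s j}([ξⱼ, ξ_{s j}])` does not
  -- depend on this choice, and along `G` the form `α` is to be `η`.
  choose s hs _ using fun j : Fin q => Fin.exists_ne_of_two_lt hq j j
  obtain ⟨α, hα⟩ := exists_contract_eq (η ∘ₗ B.proj +
    ∑ j, (-contract (B.form (s j)) ⁅B.field j, B.field (s j)⁆) • contractLin (B.form j))
  have hαT : ∀ v (hv : v ∈ G.ratTangent), contract α v = η ⟨v, hv⟩ := by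
    intro v hv
    rw [hα, LinearMap.add_apply, LinearMap.comp_apply, B.proj_of_mem hv]
    simp [contractLin_apply, contract_eq_zero hv (B.form_mem_ratConormal _)]
  have hαB : ∀ i j, i ≠ j →
      contract α (B.field j) = -contract (B.form i) ⁅B.field j, B.field i⁆ := by
    intro i j hij
    rw [hα, LinearMap.add_apply, LinearMap.comp_apply, B.proj_field,
      B.contract_commutator_field_eq hη hgen hij (hs j)]
    simp [contractLin_apply, B.contract_field]
  refine ⟨α, fun i => ?_⟩
  have hT : ∀ u ∈ G.ratTangent, ∀ v,
      exteriorDerivative (B.form i) u v = wedge α (B.form i) u v := by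
    intro u hu v
    have h0 := contract_eq_zero hu (B.form_mem_ratConormal i)
    simp only [exteriorDerivative, wedge, bott_apply (B.form_mem i) hu, hαT u hu, h0, map_zero]
    ring
  have key := B.eq_zero_of_forall
    (fun v => exteriorDerivativeLin (B.form i) v - wedgeLin α (B.form i) v)
  simp only [LinearMap.sub_apply, wedgeLin_apply, sub_eq_zero] at key
  funext u v
  refine key (fun u v => ?_) ?_ v u
  · change exteriorDerivative _ v u - _ = -(exteriorDerivative _ u v - _)
    rw [exteriorDerivative_neg_swap, wedge_neg_swap]
    ring
  rintro v hv u (hu | ⟨j, rfl⟩)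
  · exact hT u hu v
  rcases hv with hv | ⟨k, rfl⟩
  · change exteriorDerivative _ _ _ = _
    rw [exteriorDerivative_neg_swap, hT v hv, ← wedge_neg_swap]
  · change exteriorDerivative _ _ _ = _
    simp only [exteriorDerivative, wedge, B.contract_field]
    rcases eq_or_ne i j with rfl | hj
    · rcases eq_or_ne i k with rfl | hk
      · simp
        exact map_zero (contractLin (B.form i))
      · rw [hαB i k hk, ← lie_skew, contract_neg]
        simp [hk]
    · rcases eq_or_ne i k with rfl | hk
      · rw [hαB i j hj]
        simp [hj]
      · rw [B.contract_commutator_field_ne hη hgen hj hk]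
        simp [hj, hk]

/-- Each tangent or frame field is killed by all forms of the frame but at most one. Given two of
them, `q > 2` leaves an `ωᵢ` killing both, and `dα ∧ ωᵢ = 0` evaluated on them and `ξᵢ` isolates
`dα`. -/
theorem exteriorDerivative_eq_zero (hq : 2 < q) {α : X.RatForm}
    (hα : ∀ i, exteriorDerivative (B.form i) = wedge α (B.form i)) :
    exteriorDerivative α = 0 := by
  have hS : ∀ u ∈ (G.ratTangent : Set X.RatVectorField) ∪ Set.range B.field,
      ∃ j, ∀ i ≠ j, contract (B.form i) u = 0 := by
    rintro u (hu | ⟨j, rfl⟩)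
    · exact ⟨⟨0, by lia⟩, fun i _ => contract_eq_zero hu (B.form_mem_ratConormal i)⟩
    · exact ⟨j, fun i hi => by simp [B.contract_field, hi]⟩
  funext u v
  refine B.eq_zero_of_forall (exteriorDerivativeLin α)
    (fun u v => exteriorDerivative_neg_swap α v u) (fun v hv u hu => ?_) v u
  obtain ⟨j, hj⟩ := hS u hu
  obtain ⟨k, hk⟩ := hS v hv
  obtain ⟨i, hij, hik⟩ := Fin.exists_ne_of_two_lt hq j k
  have h := exteriorDerivative_cyclic (hα i) u v (B.field i)
  rw [hj i hij, hk i hik, B.contract_field, if_pos rfl] at h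
  change exteriorDerivative α u v = 0
  linear_combination h

end EigenFrame

end Foliation

/-! ### The foliation defined by an integrable rational form -/

/-- The regular `1`-forms on `U` which are rational multiples of `ω`. -/
noncomputable def formConormal (ω : X.RatForm) (U : X.toScheme.affineOpens) :
    Submodule Γ(X.toScheme, U) Ω[Γ(X.toScheme, U)⁄ℂ] :=
  ⨅ _ : Nonempty U.1, ((Submodule.span X.RatFun {ω}).restrictScalars Γ(X.toScheme, U)).comap
    (X.toRatForm U.1)

theorem mem_formConormal {ω : X.RatForm} {U : X.toScheme.affineOpens} [Nonempty U.1]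
    {α : Ω[Γ(X.toScheme, U)⁄ℂ]} :
    α ∈ formConormal ω U ↔ X.toRatForm U.1 α ∈ Submodule.span X.RatFun {ω} := by
  rw [formConormal, iInf_pos ‹_›]
  rfl

/-- The regular vector fields on `U` annihilated by `formConormal ω U`. -/
noncomputable def formTangent (ω : X.RatForm) (U : X.toScheme.affineOpens) :
    Submodule Γ(X.toScheme, U) (Derivation ℂ Γ(X.toScheme, U) Γ(X.toScheme, U)) :=
  (formConormal ω U).dualAnnihilator.comap
    (KaehlerDifferential.linearMapEquivDerivation ℂ Γ(X.toScheme, U)).symm.toLinearMap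

theorem mem_formTangent {ω : X.RatForm} {U : X.toScheme.affineOpens}
    {v : Derivation ℂ Γ(X.toScheme, U) Γ(X.toScheme, U)} :
    v ∈ formTangent ω U ↔ ∀ α ∈ formConormal ω U, v.liftKaehlerDifferential α = 0 :=
  Submodule.mem_dualAnnihilator _

/-- Some nonzero multiple of `ω` is regular on `U`, so killing the regular multiples amounts to
killing `ω`. -/
theorem mem_formTangent_iff_contract {ω : X.RatForm} {U : X.toScheme.affineOpens} [Nonempty U.1]
    {v : Derivation ℂ Γ(X.toScheme, U) Γ(X.toScheme, U)} {w : X.RatVectorField}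
    (hw : w.Extends v) : v ∈ formTangent ω U ↔ contract ω w = 0 := by
  rw [mem_formTangent]
  constructor
  · intro h
    obtain ⟨a, ha, α, hα⟩ := KaehlerDifferential.exists_smul_eq_map Γ(X.toScheme, U) ω
    have h1 := h α (mem_formConormal.mpr (by
      rw [toRatForm, hα]; exact Submodule.smul_mem _ _ (Submodule.mem_span_singleton_self ω)))
    have h2 := contract_toRatForm hw α
    rw [h1, map_zero, toRatForm, hα, contract_smul_left] at h2
    exact (mul_eq_zero.mp h2).resolve_left
      (IsFractionRing.to_map_ne_zero_of_mem_nonZeroDivisors ha)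
  · intro h α hα
    obtain ⟨a, ha⟩ := Submodule.mem_span_singleton.mp (mem_formConormal.mp hα)
    apply IsFractionRing.injective Γ(X.toScheme, U) X.RatFun
    rw [map_zero, ← contract_toRatForm hw, ← ha, contract_smul_left, h, mul_zero]

namespace Foliation

/-- The codimension one foliation defined by a rational `1`-form with involutive kernel. -/
noncomputable def ofForm (ω : X.RatForm)
    (hω : ∀ v w, contract ω v = 0 → contract ω w = 0 → contract ω ⁅v, w⁆ = 0) :
    X.Foliation where
  conormal := formConormal ω
  tangent := formTangent ω
  tangent_restrict U V h v hv w hw := by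
    by_cases hV : Nonempty V.1
    · have hU : Nonempty U.1 := hV.map (Set.inclusion h)
      obtain ⟨v', hv'⟩ := w.exists_extends (B := X.RatFun)
      refine (mem_formTangent_iff_contract hv').mpr
        ((mem_formTangent_iff_contract fun f => ?_).mp hv)
      have := hv' (X.restrict h f)
      rwa [hw, algebraMap_restrict, algebraMap_restrict] at this
    · have := subsingleton_sections V hV
      have : Subsingleton (Derivation ℂ Γ(X.toScheme, V) Γ(X.toScheme, V)) :=
        Module.subsingleton Γ(X.toScheme, V) _
      rw [Subsingleton.elim w 0]
      exact zero_mem _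
  conormal_restrict U V h α hα := by
    by_cases hV : Nonempty V.1
    · have hU : Nonempty U.1 := hV.map (Set.inclusion h)
      rw [mem_formConormal, toRatForm_restrictForm]
      exact mem_formConormal.mp hα
    · have := subsingleton_sections V hV
      have : Subsingleton Ω[Γ(X.toScheme, V)⁄ℂ] := Module.subsingleton Γ(X.toScheme, V) _
      rw [Subsingleton.elim (X.restrictForm h α) 0]
      exact zero_mem _
  mem_tangent_iff U v := mem_formTangent
  mem_conormal_iff U α := by
    refine ⟨fun hα v hv => mem_formTangent.mp hv α hα, fun h => ?_⟩
    by_cases hU : Nonempty U.1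
    · refine mem_formConormal.mpr (Derivation.lift_eq_zero_of_forall _ _ fun w hw => ?_)
      obtain ⟨a, ha, v, hv⟩ := w.exists_smul_extends (A := Γ(X.toScheme, U))
      have hv0 := (mem_formTangent_iff_contract (ω := ω) hv).mpr (by
        rw [contract_smul, contract, hw ω (Submodule.mem_span_singleton_self ω), mul_zero])
      have h1 := contract_toRatForm hv α
      rw [h v hv0, map_zero, contract_smul] at h1
      exact (mul_eq_zero.mp h1).resolve_left
        (IsFractionRing.to_map_ne_zero_of_mem_nonZeroDivisors ha)
    · have := subsingleton_sections U hU
      have : Subsingleton Ω[Γ(X.toScheme, U)⁄ℂ] := Module.subsingleton Γ(X.toScheme, U) _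
      rw [Subsingleton.elim α 0]
      exact zero_mem _
  involutive U v hv w hw := by
    by_cases hU : Nonempty U.1
    · obtain ⟨v', hv'⟩ := v.exists_extends (B := X.RatFun)
      obtain ⟨w', hw'⟩ := w.exists_extends (B := X.RatFun)
      refine (mem_formTangent_iff_contract (w := ⁅v', w'⁆) fun f => ?_).mpr
        (hω v' w' ((mem_formTangent_iff_contract hv').mp hv)
          ((mem_formTangent_iff_contract hw').mp hw))
      rw [Derivation.commutator_apply, hv', hw', hw', hv', Derivation.commutator_apply, map_sub]
    · have := subsingleton_sections U hU
      have : Subsingleton (Derivation ℂ Γ(X.toScheme, U) Γ(X.toScheme, U)) :=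
        Module.subsingleton Γ(X.toScheme, U) _
      rw [Subsingleton.elim ⁅v, w⁆ 0]
      exact zero_mem _

theorem ratConormal_ofForm (ω : X.RatForm)
    (hω : ∀ v w, contract ω v = 0 → contract ω w = 0 → contract ω ⁅v, w⁆ = 0) :
    (ofForm ω hω).ratConormal = Submodule.span X.RatFun {ω} := by
  refine le_antisymm (Submodule.span_le.mpr ?_) ((Submodule.span_singleton_le_iff_mem _ _).mpr ?_)
  · rintro _ ⟨U, hU, α, hα, rfl⟩
    exact mem_formConormal.mp hα
  · obtain ⟨U, hU⟩ := X.nonempty_affineOpens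
    obtain ⟨a, ha, α, hα⟩ := KaehlerDifferential.exists_smul_eq_map Γ(X.toScheme, U) ω
    have h1 : X.toRatForm U.1 α ∈ (ofForm ω hω).ratConormal :=
      toRatForm_mem_ratConormal _ U (mem_formConormal.mpr (by
        rw [toRatForm, hα]; exact Submodule.smul_mem _ _ (Submodule.mem_span_singleton_self ω)))
    rwa [toRatForm, hα, Submodule.smul_mem_iff _
      (IsFractionRing.to_map_ne_zero_of_mem_nonZeroDivisors ha)] at h1

/-! ### Codimension one foliations containing `G` and projective space -/

variable {G : X.Foliation} {η : G.RatLeafForm}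

namespace EigenFrame

variable {q : ℕ} (B : EigenFrame G η q)

/-- The eigenform with constant components `s`. -/
noncomputable def comb (s : Fin q → ℂ) : X.RatForm := ∑ i, s i • B.form i

theorem comb_eq (s : Fin q → ℂ) :
    B.comb s = ∑ i, algebraMap ℂ X.RatFun (s i) • B.form i := by
  simp [comb, algebraMap_smul]

theorem contract_comb (s : Fin q → ℂ) (j : Fin q) :
    contract (B.comb s) (B.field j) = algebraMap ℂ X.RatFun (s j) := by
  rw [comb_eq, contract_sum_form]

theorem comb_mem (s : Fin q → ℂ) : B.comb s ∈ G.ratConormal := by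
  rw [comb_eq]
  exact sum_mem fun i _ => Submodule.smul_mem _ _ (B.form_mem_ratConormal i)

theorem comb_smul (c : ℂ) (s : Fin q → ℂ) :
    B.comb (c • s) = algebraMap ℂ X.RatFun c • B.comb s := by
  simp [comb, Finset.smul_sum, algebraMap_smul, mul_smul]

theorem comb_ne_zero {s : Fin q → ℂ} (hs : s ≠ 0) : B.comb s ≠ 0 := by
  obtain ⟨j, hj⟩ := Function.ne_iff.mp hs
  intro h
  have := B.contract_comb s j
  rw [h, contract_zero_left] at this
  exact hj ((map_eq_zero _).mp this.symm)

theorem exteriorDerivative_comb {α : X.RatForm}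
    (hα : ∀ i, exteriorDerivative (B.form i) = wedge α (B.form i)) (s : Fin q → ℂ) :
    exteriorDerivative (B.comb s) = wedge α (B.comb s) := by
  funext u v
  have h : ∀ i, u (contract (B.form i) v) - v (contract (B.form i) u) -
      contract (B.form i) ⁅u, v⁆ =
        contract α u * contract (B.form i) v - contract α v * contract (B.form i) u :=
    fun i => congrFun (congrFun (hα i) u) v
  simp only [exteriorDerivative, wedge, comb_eq, contract_sum_left, contract_smul_left, map_sum,
    Derivation.leibniz, Derivation.map_algebraMap, smul_eq_mul,
    Finset.mul_sum, ← Finset.sum_sub_distrib]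
  exact Finset.sum_congr rfl fun i _ => by linear_combination algebraMap ℂ X.RatFun (s i) * h i

theorem contract_commutator_of_exteriorDerivative {ω α : X.RatForm}
    (h : exteriorDerivative ω = wedge α ω) (v w : X.RatVectorField) (hv : contract ω v = 0)
    (hw : contract ω w = 0) : contract ω ⁅v, w⁆ = 0 := by
  have := congrFun (congrFun h v) w
  simp only [exteriorDerivative, wedge, hv, hw, map_zero] at this
  linear_combination -this

/-- Eigenforms form a complex vector space with the frame as basis. -/
noncomputable def basis (hη : ¬ G.IsLogExact η) : Module.Basis (Fin q) ℂ (G.eigenspace η) :=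
  Module.Basis.mk (v := fun i => (⟨B.form i, B.form_mem i⟩ : G.eigenspace η))
    (by
      rw [Fintype.linearIndependent_iff]
      intro s hs i
      by_contra hi
      refine B.comb_ne_zero (s := s) (fun h => hi (congrFun h i)) ?_
      have := congrArg Subtype.val hs
      rw [AddSubmonoidClass.coe_finsetSum] at this
      exact this)
    (by
      rintro ⟨ω, hω⟩ -
      -- The frame is basic, so the components of an eigenform are first integrals, hence complex
      -- numbers.
      have h : ∀ j, ∃ c : ℂ, algebraMap ℂ X.RatFun c = contract ω (B.field j) := fun j =>
        B.mem_range_of_mem_firstIntegrals hη (f := contract ω (B.field j))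
          fun v hv => B.isBasic_field j ω hω v hv
      choose s hs using h
      refine (Submodule.mem_span_range_iff_exists_fun ℂ).mpr ⟨s, Subtype.ext ?_⟩
      rw [AddSubmonoidClass.coe_finsetSum]
      change B.comb s = ω
      simp only [comb_eq, hs]
      exact B.sum_contract_smul_form hω.1)

theorem coe_basis (hη : ¬ G.IsLogExact η) (i : Fin q) :
    (B.basis hη i : X.RatForm) = B.form i := by
  simp [basis]

/-- The rational factor between the two forms is read off from a nonzero component, as a quotient of
two complex numbers. -/
theorem mk_eq_mk_of_span_eq {s t : Fin q → ℂ} (hs : s ≠ 0) (ht : t ≠ 0)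
    (h : Submodule.span X.RatFun {B.comb s} = Submodule.span X.RatFun {B.comb t}) :
    Projectivization.mk ℂ s hs = Projectivization.mk ℂ t ht := by
  have h1 : B.comb s ∈ Submodule.span X.RatFun {B.comb t} :=
    h ▸ Submodule.mem_span_singleton_self _
  obtain ⟨a, ha⟩ := Submodule.mem_span_singleton.mp h1
  have h2 : ∀ j, a * algebraMap ℂ X.RatFun (t j) = algebraMap ℂ X.RatFun (s j) := fun j => by
    rw [← B.contract_comb t, ← B.contract_comb s, ← ha, contract_smul_left]
  obtain ⟨j, hj⟩ := Function.ne_iff.mp ht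
  rw [Projectivization.mk_eq_mk_iff']
  refine ⟨s j / t j, funext fun i => (algebraMap ℂ X.RatFun).injective ?_⟩
  have hj' : algebraMap ℂ X.RatFun (t j) ≠ 0 := (map_ne_zero _).mpr hj
  rw [Pi.smul_apply, smul_eq_mul, map_mul, map_div₀, ← h2 j, ← h2 i]
  field_simp

/-- Every codimension one foliation containing `G` is defined by an eigenform. -/
theorem exists_isDefinedBy_comb (hη : ¬ G.IsLogExact η) {F : X.Foliation} (hF : F.codim = 1)
    (hFG : F.Contains G) : ∃ s : Fin q → ℂ, s ≠ 0 ∧ F.IsDefinedBy (B.comb s) := by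
  have hle := contains_iff.mp hFG
  obtain ⟨⟨ω, hω⟩, hne, hspan⟩ := finrank_eq_one_iff'.mp hF
  have hne' : ω ≠ 0 := fun h => hne (Subtype.ext h)
  have hF' : F.ratConormal = Submodule.span X.RatFun {ω} := by
    refine le_antisymm (fun θ hθ => ?_) ((Submodule.span_singleton_le_iff_mem _ _).mpr hω)
    obtain ⟨c, hc⟩ := hspan ⟨θ, hθ⟩
    exact Submodule.mem_span_singleton.mpr ⟨c, congrArg Subtype.val hc⟩
  have hT : ∀ v ∈ G.ratTangent, v ∈ F.ratTangent := fun v hv =>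
    F.mem_ratTangent_iff.mpr fun θ hθ => contract_eq_zero hv (hle hθ)
  -- The form `θ = dω(v, ·)` kills `T_F` because `F` is involutive and `v` lies in it; so `θ` is a
  -- multiple `b ω`, that is, `∇_v ω = b ω`.
  have hb : ∀ v ∈ G.ratTangent, ∃ b : X.RatFun, ∀ ξ,
      v (contract ω ξ) - contract ω ⁅v, ξ⁆ = b * contract ω ξ := by
    intro v hv
    have h0 : contract ω v = 0 := contract_eq_zero (hT v hv) hω
    obtain ⟨θ, hθ⟩ := exists_contract_eq (-exteriorDerivativeLin ω v)
    have hθ' : ∀ ξ, contract θ ξ = v (contract ω ξ) - contract ω ⁅v, ξ⁆ := by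
      intro ξ
      rw [hθ]
      change -exteriorDerivative ω ξ v = _
      rw [exteriorDerivative_neg_swap, exteriorDerivative, h0, map_zero]
      ring
    have hθF : θ ∈ F.ratConormal := by
      rw [mem_ratConormal_iff]
      intro ξ hξ
      rw [hθ', contract_eq_zero hξ hω,
        contract_eq_zero (commutator_mem_ratTangent (hT v hv) hξ) hω, map_zero, sub_zero]
    rw [hF'] at hθF
    obtain ⟨b, rfl⟩ := Submodule.mem_span_singleton.mp hθF
    exact ⟨b, fun ξ => by rw [← hθ', contract_smul_left]⟩
  have hj : ∃ j, contract ω (B.field j) ≠ 0 := by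
    by_contra! h
    apply hne'
    rw [← B.sum_contract_smul_form (hle hω)]
    exact Finset.sum_eq_zero fun i _ => by rw [h, zero_smul]
  obtain ⟨j, hj⟩ := hj
  -- All components obey `v(c) = (b - η(v)) c` with the same factor, so their quotients are first
  -- integrals.
  have hs : ∀ i, ∃ c : ℂ, algebraMap ℂ X.RatFun c =
      contract ω (B.field i) / contract ω (B.field j) := by
    intro i
    refine B.mem_range_of_mem_firstIntegrals hη fun v hv => ?_
    obtain ⟨b, hb⟩ := hb v hv
    rw [Derivation.leibniz_div, B.apply_contract_field (hle hω) hv hb,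
      B.apply_contract_field (hle hω) hv hb]
    simp only [smul_eq_mul]
    ring
  choose s hs using hs
  have hcomb : ω = contract ω (B.field j) • B.comb s := by
    conv_lhs => rw [← B.sum_contract_smul_form (hle hω)]
    rw [comb_eq, Finset.smul_sum]
    refine Finset.sum_congr rfl fun i _ => ?_
    rw [hs, smul_smul, mul_div_cancel₀ _ hj]
  have hs0 : s ≠ 0 := by
    rintro rfl
    apply hne'
    rw [hcomb]
    simp [comb]
  refine ⟨s, hs0, B.comb_ne_zero hs0, ?_⟩
  rw [hF', hcomb, Submodule.span_singleton_smul_eq (IsUnit.mk0 _ hj)]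

theorem span_comb_rep {s : Fin q → ℂ} (hs : s ≠ 0) :
    Submodule.span X.RatFun {B.comb (Projectivization.mk ℂ s hs).rep} =
      Submodule.span X.RatFun {B.comb s} := by
  obtain ⟨a, ha⟩ := Projectivization.exists_smul_eq_mk_rep ℂ s hs
  rw [← ha, Units.smul_def, comb_smul, Submodule.span_singleton_smul_eq]
  exact (a.isUnit.map (algebraMap ℂ X.RatFun))

/-- The codimension one foliations containing `G` are parametrized by a projective space. -/
theorem exists_equiv (hη : ¬ G.IsLogExact η) {α : X.RatForm}
    (hα : ∀ i, exteriorDerivative (B.form i) = wedge α (B.form i)) :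
    ∃ Φ : ℙ ℂ (Fin q → ℂ) ≃ {F : X.Foliation // F.codim = 1 ∧ F.Contains G},
      ∀ (s : Fin q → ℂ) (hs : s ≠ 0),
        (Φ (Projectivization.mk ℂ s hs)).1.IsDefinedBy (B.comb s) := by
  let Ψ (s : Fin q → ℂ) : X.Foliation := ofForm (B.comb s)
    (contract_commutator_of_exteriorDerivative (B.exteriorDerivative_comb hα s))
  have hΨ (s) : (Ψ s).ratConormal = Submodule.span X.RatFun {B.comb s} := ratConormal_ofForm _ _
  have hΨ1 (s) (hs : s ≠ 0) : (Ψ s).codim = 1 := by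
    rw [codim, hΨ, finrank_span_singleton (B.comb_ne_zero hs)]
  have hΨ2 (s) : (Ψ s).Contains G := by
    rw [contains_iff, hΨ, Submodule.span_singleton_le_iff_mem]
    exact B.comb_mem s
  let Φ (p : ℙ ℂ (Fin q → ℂ)) : {F : X.Foliation // F.codim = 1 ∧ F.Contains G} :=
    ⟨Ψ p.rep, hΨ1 _ p.rep_nonzero, hΨ2 _⟩
  have hΦ (s) (hs : s ≠ 0) :
      (Φ (Projectivization.mk ℂ s hs)).1.ratConormal = Submodule.span X.RatFun {B.comb s} :=
    (hΨ _).trans (B.span_comb_rep hs)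
  refine ⟨Equiv.ofBijective Φ ⟨fun p p' => ?_, fun F => ?_⟩, fun s hs =>
    ⟨B.comb_ne_zero hs, hΦ s hs⟩⟩
  · induction p with | h s hs =>
    induction p' with | h t ht =>
    intro h
    apply B.mk_eq_mk_of_span_eq
    rw [← hΦ s hs, ← hΦ t ht, h]
  · obtain ⟨s, hs, h⟩ := B.exists_isDefinedBy_comb hη F.2.1 F.2.2
    exact ⟨Projectivization.mk ℂ s hs, Subtype.ext (ext_ratConormal ((hΦ s hs).trans h.2.symm))⟩

end EigenFrame

end Foliation

end ProjectiveManifold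

/-! ### Generalized Wronskians -/

section Wronskian

variable {k A K : Type} [Field k] [CommRing A] [Field K] [Algebra k K] [Algebra A K]
  [Algebra k A] [IsScalarTower k A K]

/-- The composition of a list of derivations. -/
def Derivation.iterate (w : List (Derivation k A A)) : A →ₗ[k] A :=
  w.foldr (fun v g => v.toLinearMap ∘ₗ g) LinearMap.id

@[simp]
theorem Derivation.iterate_nil (f : A) : Derivation.iterate ([] : List (Derivation k A A)) f = f :=
  rfl

@[simp]
theorem Derivation.iterate_cons (v : Derivation k A A) (w : List (Derivation k A A)) (f : A) :
    Derivation.iterate (v :: w) f = v (Derivation.iterate w f) := rfl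

/-- A linear relation over `K` between the iterated derivatives of functions which are linearly
independent over the field of constants is trivial. -/
theorem Derivation.eq_zero_of_iterate [IsFractionRing A K] {ι : Type*} [Fintype ι]
    (T : Set (Derivation k A A))
    (hT : ∀ f : K, (∀ v ∈ T, ∀ w : Derivation k K K, w.Extends v → w f = 0) →
      ∃ c : k, algebraMap k K c = f)
    {f : ι → A} (hf : LinearIndependent k f) (c : ι → K)
    (hc : ∀ w : List (Derivation k A A), (∀ v ∈ w, v ∈ T) →
      ∑ j, c j * algebraMap A K (Derivation.iterate w (f j)) = 0) : c = 0 := by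
  classical
  induction h : (Finset.univ.filter fun j => c j ≠ 0).card using Nat.strong_induction_on
    generalizing c with
  | _ n ih =>
  by_contra hne
  obtain ⟨j₀, hj₀⟩ := Function.ne_iff.mp hne
  have hj₀ : c j₀ ≠ 0 := hj₀
  -- A shortest-relation argument: after scaling the `j₀` coefficient to `1`, differentiating gives
  -- a relation with strictly fewer nonzero coefficients.
  let d : ι → K := fun j => c j / c j₀
  have hd : ∀ w : List (Derivation k A A), (∀ v ∈ w, v ∈ T) →
      ∑ j, d j * algebraMap A K (Derivation.iterate w (f j)) = 0 := by
    intro w hw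
    simp only [d, div_eq_inv_mul, mul_assoc]
    rw [← Finset.mul_sum, hc w hw, mul_zero]
  -- By induction the differentiated relation is trivial, so all `d j` are constants; the empty word
  -- then contradicts independence over `k`.
  have hconst : ∀ j, ∃ a : k, algebraMap k K a = d j := by
    intro j
    refine hT _ fun v hv V hV => ?_
    refine congrFun (ih (Finset.univ.filter fun j => V (d j) ≠ 0).card ?_ (fun j => V (d j)) ?_
      rfl) j
    · rw [← h]
      refine Finset.card_lt_card (Finset.ssubset_iff_subset_ne.mpr ⟨fun j hj => ?_, fun he => ?_⟩)
      · simp only [Finset.mem_filter, Finset.mem_univ, true_and] at hj ⊢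
        exact fun h0 => hj (by simp [d, h0])
      · have : j₀ ∈ Finset.univ.filter fun j => c j ≠ 0 := by simpa using hj₀
        rw [← he] at this
        simp [d, hj₀] at this
    · intro w hw
      have h1 := congrArg V (hd w hw)
      have h2 := hd (v :: w) (List.forall_mem_cons.mpr ⟨hv, hw⟩)
      simp only [map_sum, Derivation.leibniz, smul_eq_mul, hV _, map_zero,
        Finset.sum_add_distrib] at h1
      simp only [Derivation.iterate_cons] at h2
      rw [h2, zero_add] at h1
      simpa only [mul_comm] using h1
  choose a ha using hconst
  have h0 := hd [] (by simp)
  simp only [Derivation.iterate_nil, ← ha, IsScalarTower.algebraMap_apply k A K, ← map_mul,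
    ← map_sum, ← Algebra.smul_def] at h0
  have h1 : a j₀ = 0 := Fintype.linearIndependent_iff.mp hf a
    ((map_eq_zero_iff _ (IsFractionRing.injective A K)).mp h0) j₀
  have h2 := ha j₀
  rw [h1, map_zero] at h2
  exact one_ne_zero ((div_self hj₀).symm.trans h2.symm)

/-- The rows of iterated derivatives span `K^ι`, since a nonzero functional killing them would be a
nontrivial relation. A basis chosen among them is the matrix. -/
theorem Derivation.exists_wronskian_ne_zero [IsFractionRing A K] {ι : Type*} [Fintype ι]
    [DecidableEq ι] (T : Set (Derivation k A A))
    (hT : ∀ f : K, (∀ v ∈ T, ∀ w : Derivation k K K, w.Extends v → w f = 0) →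
      ∃ c : k, algebraMap k K c = f)
    {f : ι → A} (hf : LinearIndependent k f) :
    ∃ W : ι → List (Derivation k A A), (∀ i, ∀ v ∈ W i, v ∈ T) ∧
      (Matrix.of fun i j => Derivation.iterate (W i) (f j)).det ≠ 0 := by
  let S : Set (ι → K) := {r | ∃ w : List (Derivation k A A), (∀ v ∈ w, v ∈ T) ∧
    r = fun j => algebraMap A K (Derivation.iterate w (f j))}
  have hS : Submodule.span K S = ⊤ := by
    by_contra hne
    obtain ⟨φ, hφ, hker⟩ := Submodule.exists_le_ker_of_lt_top _ (lt_top_iff_ne_top.mpr hne)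
    refine hφ ?_
    have hφ' : ∀ r, φ r = ∑ j, φ (Pi.single j 1) * r j := by
      intro r
      conv_lhs => rw [pi_eq_sum_univ' r]
      simp [mul_comm]
    have h0 := Derivation.eq_zero_of_iterate T hT hf (fun j => φ (Pi.single j 1)) fun w hw => by
      have := hker (Submodule.subset_span (s := S) ⟨w, hw, rfl⟩)
      rwa [LinearMap.mem_ker, hφ'] at this
    ext r
    simp [congrFun h0]
  obtain ⟨r, hrS, -, hli⟩ := Submodule.exists_fun_fin_finrank_span_eq K S
  have hfin : Module.finrank K (Submodule.span K S) = Fintype.card ι := by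
    rw [hS, finrank_top, Module.finrank_fintype_fun_eq_card]
  let e : ι ≃ Fin (Module.finrank K (Submodule.span K S)) :=
    (Fintype.equivFin ι).trans (finCongr hfin.symm)
  choose w hw hr using hrS
  refine ⟨fun i => w (e i), fun i => hw (e i), fun hdet => ?_⟩
  have h1 : LinearIndependent K (Matrix.of fun i j =>
      algebraMap A K (Derivation.iterate (w (e i)) (f j))).row := by
    have h : (Matrix.of fun i j =>
        algebraMap A K (Derivation.iterate (w (e i)) (f j))).row = r ∘ e :=
      funext fun i => (hr (e i)).symm
    rw [h]
    exact hli.comp e e.injective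
  rw [Matrix.linearIndependent_rows_iff_isUnit, Matrix.isUnit_iff_isUnit_det] at h1
  refine h1.ne_zero ?_
  have := congrArg (algebraMap A K) hdet
  rw [map_zero, RingHom.map_det] at this
  exact this

theorem Derivation.sum_smul_eq_zero_of_iterate {ι : Type*} [Fintype ι] [DecidableEq ι]
    {f : ι → A} {W : ι → List (Derivation k A A)} (x : A →ₐ[k] k)
    (hx : x (Matrix.of fun i j => Derivation.iterate (W i) (f j)).det ≠ 0) (c : ι → k)
    (hc : ∀ i, x (Derivation.iterate (W i) (∑ j, c j • f j)) = 0) : ∑ j, c j • f j = 0 := by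
  have h : c = 0 := by
    rw [← AlgHom.coe_toRingHom, RingHom.map_det] at hx
    refine Matrix.eq_zero_of_mulVec_eq_zero hx (funext fun i => ?_)
    have := hc i
    simp only [map_sum] at this
    simpa [Matrix.mulVec, dotProduct, mul_comm] using this
  simp [h]

end Wronskian

/-! ### Integral curves on affine varieties -/

section IntegralCurves

theorem MvPolynomial.contDiff_eval {n : ℕ} (p : MvPolynomial (Fin n) ℂ) :
    ContDiff ℝ 1 fun z : Fin n → ℂ => MvPolynomial.eval z p := by
  induction p using MvPolynomial.induction_on with
  | C a => simpa using contDiff_const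
  | add p q hp hq => simpa using hp.add hq
  | mul_X p i hp => simpa using hp.mul (contDiff_apply ℝ ℂ i)

/-- The derivative of a polynomial along an integral curve of a polynomial vector field. -/
theorem MvPolynomial.hasDerivAt_eval {n : ℕ} {P : Fin n → MvPolynomial (Fin n) ℂ}
    {z : ℝ → Fin n → ℂ} {t : ℝ} (hz : HasDerivAt z (fun i => MvPolynomial.eval (z t) (P i)) t)
    (p : MvPolynomial (Fin n) ℂ) :
    HasDerivAt (fun s => MvPolynomial.eval (z s) p)
      (MvPolynomial.eval (z t) (MvPolynomial.mkDerivation ℂ P p)) t := by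
  induction p using MvPolynomial.induction_on with
  | C a => simpa using hasDerivAt_const t a
  | add p q hp hq => simpa using hp.fun_add hq
  | mul_X p i hp =>
    simp only [map_mul, MvPolynomial.eval_X, Derivation.leibniz, MvPolynomial.mkDerivation_X,
      smul_eq_mul, map_add]
    exact (hp.fun_mul (hasDerivAt_pi.mp hz i)).congr_deriv (by ring)

/-- An integral curve of a polynomial vector field which starts at a zero of an ideal invariant by
the vector field stays in the zero set of the ideal. -/
theorem MvPolynomial.eval_eq_zero_of_hasDerivAt {n : ℕ} {P : Fin n → MvPolynomial (Fin n) ℂ}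
    {z : ℝ → Fin n → ℂ} {ε : ℝ}
    (hz : ∀ t ∈ Set.Icc 0 ε, HasDerivAt z (fun i => MvPolynomial.eval (z t) (P i)) t)
    (I : Ideal (MvPolynomial (Fin n) ℂ)) (hI : ∀ p ∈ I, MvPolynomial.mkDerivation ℂ P p ∈ I)
    (h0 : ∀ p ∈ I, MvPolynomial.eval (z 0) p = 0) {p : MvPolynomial (Fin n) ℂ} (hp : p ∈ I) {t : ℝ}
    (ht : t ∈ Set.Icc 0 ε) : MvPolynomial.eval (z t) p = 0 := by
  obtain ⟨m, g, hg⟩ := Submodule.fg_iff_exists_fin_generating_family.mp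
    (IsNoetherian.noetherian I)
  have hgI : ∀ i, g i ∈ I := fun i => hg ▸ Submodule.subset_span ⟨i, rfl⟩
  have ha : ∀ i, ∃ a : Fin m → MvPolynomial (Fin n) ℂ,
      ∑ j, a j • g j = MvPolynomial.mkDerivation ℂ P (g i) := fun i =>
    (Submodule.mem_span_range_iff_exists_fun _).mp (hg ▸ hI _ (hgI i))
  choose a ha using ha
  have hcont : ∀ q : MvPolynomial (Fin n) ℂ,
      ContinuousOn (fun t => MvPolynomial.eval (z t) q) (Set.Icc 0 ε) := fun q t ht =>
    (MvPolynomial.hasDerivAt_eval (hz t ht) q).continuousAt.continuousWithinAt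
  obtain ⟨C, hC⟩ := isCompact_Icc.exists_bound_of_continuousOn
    (f := fun t => ∑ i, ∑ j, ‖MvPolynomial.eval (z t) (a i j)‖)
    (continuousOn_finsetSum _ fun i _ => continuousOn_finsetSum _ fun j _ => (hcont (a i j)).norm)
  let u (t : ℝ) (i : Fin m) : ℂ := MvPolynomial.eval (z t) (g i)
  let u' (t : ℝ) (i : Fin m) : ℂ :=
    MvPolynomial.eval (z t) (MvPolynomial.mkDerivation ℂ P (g i))
  have hder : ∀ t ∈ Set.Icc 0 ε, HasDerivAt u (u' t) t := fun t ht =>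
    hasDerivAt_pi.mpr fun i => MvPolynomial.hasDerivAt_eval (hz t ht) (g i)
  have hu : ∀ t ∈ Set.Icc 0 ε, u t = 0 := by
    have hu0 : u 0 = 0 := by
      funext i
      have := h0 (g i) (hgI i)
      rwa [Pi.zero_apply]
    -- The generators satisfy a linear system `u' = A u` along the curve, with `u(0) = 0` and `A`
    -- bounded on the compact interval; Grönwall gives `u = 0`.
    refine eq_zero_of_abs_deriv_le_mul_abs_self_of_eq_zero_right (K := C) (f' := u')
      (fun t ht => (hder t ht).continuousAt.continuousWithinAt)
      (fun t ht => (hder t (Set.Ico_subset_Icc_self ht)).hasDerivWithinAt) hu0 fun t ht => ?_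
    have hCt := hC t (Set.Ico_subset_Icc_self ht)
    rw [Real.norm_of_nonneg (by positivity)] at hCt
    have hC0 : 0 ≤ C := le_trans (by positivity) hCt
    refine (pi_norm_le_iff_of_nonneg (by positivity)).mpr fun i => ?_
    simp only [u']
    rw [← ha i, map_sum]
    calc ‖∑ j, MvPolynomial.eval (z t) (a i j • g j)‖
        ≤ ∑ j, ‖MvPolynomial.eval (z t) (a i j)‖ *
            ‖u t‖ := by
          refine norm_sum_le_of_le _ fun j _ => ?_
          rw [smul_eq_mul, map_mul, norm_mul]
          gcongr
          exact norm_le_pi_norm (u t) j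
      _ ≤ C * ‖u t‖ := by
          rw [← Finset.sum_mul]
          gcongr
          refine le_trans ?_ hCt
          exact Finset.single_le_sum (f := fun i => ∑ j, ‖MvPolynomial.eval (z t) (a i j)‖)
            (fun i _ => by positivity) (Finset.mem_univ i)
  have hle : I ≤ RingHom.ker (MvPolynomial.eval (z t)) := by
    rw [← hg]
    refine Submodule.span_le.mpr ?_
    rintro _ ⟨i, rfl⟩
    exact congrFun (hu t ht) i
  exact hle hp

/-- Existence of integral curves, in the set of complex points of an algebra of finite type. -/
theorem Derivation.exists_integralCurve {A : Type} [CommRing A] [Algebra ℂ A]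
    [Algebra.FiniteType ℂ A] (v : Derivation ℂ A A) (y : A →ₐ[ℂ] ℂ) {h : A} (hy : y h ≠ 0) :
    ∃ (γ : ℝ → A →ₐ[ℂ] ℂ) (ε : ℝ), 0 < ε ∧ γ 0 = y ∧ (∀ t ∈ Set.Icc (0 : ℝ) 1, γ t h ≠ 0) ∧
      ∀ f, ∀ t ∈ Set.Icc (0 : ℝ) 1,
        HasDerivWithinAt (fun s => γ s f) (ε * γ t (v f)) (Set.Icc 0 1) t := by
  obtain ⟨n, φ, hφ⟩ := Algebra.FiniteType.iff_quotient_mvPolynomial''.mp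
    (inferInstance : Algebra.FiniteType ℂ A)
  have haeval : ∀ (z : Fin n → ℂ) p, MvPolynomial.aeval z p = MvPolynomial.eval z p :=
    fun z p => RingHom.congr_fun (MvPolynomial.coe_aeval_eq_eval z) p
  -- `v` lifts to a polynomial vector field on `ℂⁿ` that preserves `ker φ`, so its integral curve
  -- stays on the variety.
  choose P hP using fun i => hφ (v (φ (MvPolynomial.X i)))
  have hD : ∀ p, φ (MvPolynomial.mkDerivation ℂ P p) = v (φ p) := by
    intro p
    induction p using MvPolynomial.induction_on with
    | C a =>
      rw [← MvPolynomial.algebraMap_eq]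
      simp
    | add p q hp hq => simp [hp, hq]
    | mul_X p i hp => simp [Derivation.leibniz, hp, hP]
  let z₀ : Fin n → ℂ := fun i => y (φ (MvPolynomial.X i))
  have hz₀ : ∀ p, MvPolynomial.eval z₀ p = y (φ p) := by
    intro p
    have : MvPolynomial.aeval z₀ = y.comp φ := by
      ext i
      simp [z₀]
    exact (haeval z₀ p).symm.trans (AlgHom.congr_fun this p)
  obtain ⟨z, hz0, δ, hδ, hz⟩ :=
    ContDiffAt.exists_forall_mem_closedBall_exists_eq_forall_mem_Ioo_hasDerivAt₀
      (f := fun z : Fin n → ℂ => fun i => MvPolynomial.eval z (P i)) (x₀ := z₀)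
      (contDiff_pi.mpr fun i => MvPolynomial.contDiff_eval (P i)).contDiffAt 0
  obtain ⟨H, rfl⟩ := hφ h
  have hcont : ContinuousAt (fun t => MvPolynomial.eval (z t) H) 0 :=
    (MvPolynomial.hasDerivAt_eval (hz 0 (by constructor <;> linarith)) H).continuousAt
  have hne : ∀ᶠ t in nhds (0 : ℝ), MvPolynomial.eval (z t) H ≠ 0 :=
    hcont.eventually_ne (by rwa [hz0, hz₀])
  obtain ⟨ρ, hρ, hball⟩ := Metric.eventually_nhds_iff_ball.mp hne
  -- Small enough for the solution to exist and for `h` to stay nonzero; time is then rescaled to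
  -- `[0, 1]`.
  let ε : ℝ := min δ ρ / 2
  have hε : 0 < ε := half_pos (lt_min hδ hρ)
  have hεm : ε < min δ ρ := half_lt_self (lt_min hδ hρ)
  have hεδ : ε < δ := hεm.trans_le (min_le_left _ _)
  have hερ : ε < ρ := hεm.trans_le (min_le_right _ _)
  have hzI : ∀ t ∈ Set.Icc 0 ε, HasDerivAt z (fun i => MvPolynomial.eval (z t) (P i)) t :=
    fun t ht => hz t ⟨by linarith [ht.1], by linarith [ht.2]⟩
  have hscale : ∀ t ∈ Set.Icc (0 : ℝ) 1, ε * t ∈ Set.Icc 0 ε := fun t ht =>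
    ⟨mul_nonneg hε.le ht.1, mul_le_of_le_one_right hε.le ht.2⟩
  have hex : ∀ t, ∃ χ : A →ₐ[ℂ] ℂ, t ∈ Set.Icc (0 : ℝ) 1 →
      ∀ p, χ (φ p) = MvPolynomial.eval (z (ε * t)) p := by
    intro t
    by_cases ht : t ∈ Set.Icc (0 : ℝ) 1
    · have hker : ∀ p ∈ RingHom.ker φ, MvPolynomial.aeval (z (ε * t)) p = 0 := by
        intro p hp
        refine (haeval _ p).trans ?_
        refine MvPolynomial.eval_eq_zero_of_hasDerivAt hzI (RingHom.ker φ) (fun p hp => ?_)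
          (fun p hp => ?_) hp (hscale t ht)
        · rw [RingHom.mem_ker] at hp ⊢
          rw [hD, hp, map_zero]
        · rw [hz0, hz₀, (RingHom.mem_ker).mp hp, map_zero]
      refine ⟨(Ideal.Quotient.liftₐ (RingHom.ker φ) _ hker).comp
        (Ideal.quotientKerAlgEquivOfSurjective hφ).symm.toAlgHom, fun _ p => ?_⟩
      have : (Ideal.quotientKerAlgEquivOfSurjective hφ).symm (φ p) =
          Ideal.Quotient.mk (RingHom.ker φ) p := by
        rw [AlgEquiv.symm_apply_eq]
        rfl
      change Ideal.Quotient.liftₐ (RingHom.ker φ) _ hker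
        ((Ideal.quotientKerAlgEquivOfSurjective hφ).symm (φ p)) = _
      rw [this]
      exact haeval _ p
    -- Outside `[0, 1]` the curve takes the arbitrary value `y`.
    · exact ⟨y, fun h => absurd h ht⟩
  choose γ hγ using hex
  refine ⟨γ, ε, hε, ?_, fun t ht => ?_, fun f t ht => ?_⟩
  · ext f
    obtain ⟨p, rfl⟩ := hφ f
    rw [hγ 0 ⟨le_rfl, zero_le_one⟩, mul_zero, hz0, hz₀]
  · rw [hγ t ht]
    refine hball _ ?_
    have := hscale t ht
    rw [Metric.mem_ball, Real.dist_eq, sub_zero, abs_of_nonneg this.1]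
    exact this.2.trans_lt hερ
  · obtain ⟨p, rfl⟩ := hφ f
    have h1 := MvPolynomial.hasDerivAt_eval (hzI _ (hscale t ht)) p
    have h2 : HasDerivAt (fun s : ℝ => ε * s) ε t := by
      simpa using (hasDerivAt_id t).const_mul ε
    have h3 := (h1.scomp t h2).hasDerivWithinAt (s := Set.Icc 0 1)
    rw [Complex.real_smul] at h3
    rw [← hD, hγ t ht]
    exact h3.congr (fun s hs => hγ s hs p) (hγ t ht p)

end IntegralCurves

/-! ### Complex points as algebra homomorphisms -/

namespace ProjectiveManifold

variable {X : ProjectiveManifold}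

theorem specMap_ΓSpecIso_hom_comp_fromSpec :
    Spec.map (Scheme.ΓSpecIso (.of ℂ)).hom ≫ (isAffineOpen_top (Spec (.of ℂ))).fromSpec =
      𝟙 (Spec (.of ℂ)) := by
  rw [IsAffineOpen.fromSpec_top, Scheme.isoSpec_Spec_inv, ← Spec.map_comp, Iso.inv_hom_id,
    Spec.map_id]

namespace Point

variable {U : X.toScheme.Opens}

/-- Evaluation at a point, as a homomorphism of algebras. -/
noncomputable def evalHom (p : {p : X.Point // ⊤ ≤ p.hom ⁻¹ᵁ U}) : Γ(X.toScheme, U) →ₐ[ℂ] ℂ where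
  toRingHom := (p.1.hom.appLE U ⊤ p.2 ≫ (Scheme.ΓSpecIso (.of ℂ)).hom).hom
  commutes' c := by
    have hle : U ≤ X.str ⁻¹ᵁ ⊤ := le_top
    have h1 : X.str.appLE ⊤ U hle ≫ p.1.hom.appLE U ⊤ p.2 = 𝟙 _ := by
      rw [Scheme.Hom.appLE_comp_appLE]
      have h := p.1.hom_str
      simp only [h]
      simp only [Scheme.Hom.appLE, Scheme.Hom.id_app]
      exact (Spec (.of ℂ)).presheaf.map_id _
    have h2 : ((Scheme.ΓSpecIso (.of ℂ)).inv ≫ X.str.appLE ⊤ U le_top) ≫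
        (p.1.hom.appLE U ⊤ p.2 ≫ (Scheme.ΓSpecIso (.of ℂ)).hom) = 𝟙 _ := by
      rw [Category.assoc, reassoc_of% h1, Iso.inv_hom_id]
    exact congrArg (fun φ => φ.hom c) h2

/-- A point of an affine open is recovered from its evaluation map. This makes `evalHom` injective,
so a curve of algebra homomorphisms is a curve of points. -/
theorem specMap_evalHom_comp_fromSpec (hU : IsAffineOpen U)
    (p : {p : X.Point // ⊤ ≤ p.hom ⁻¹ᵁ U}) :
    Spec.map (CommRingCat.ofHom (evalHom p).toRingHom) ≫ hU.fromSpec = p.1.hom := by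
  have h : CommRingCat.ofHom (evalHom p).toRingHom =
      p.1.hom.appLE U ⊤ p.2 ≫ (Scheme.ΓSpecIso (.of ℂ)).hom := rfl
  rw [h, Spec.map_comp, Category.assoc,
    IsAffineOpen.SpecMap_appLE_fromSpec _ hU (isAffineOpen_top _), ← Category.assoc,
    specMap_ΓSpecIso_hom_comp_fromSpec, Category.id_comp]

theorem evalHom_injective (hU : IsAffineOpen U) :
    Function.Injective (evalHom : {p : X.Point // ⊤ ≤ p.hom ⁻¹ᵁ U} → _) := by
  intro p p' h
  refine Subtype.ext (Point.ext ?_)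
  rw [← specMap_evalHom_comp_fromSpec hU p, h, specMap_evalHom_comp_fromSpec hU p']

theorem evalHom_surjective (hU : IsAffineOpen U) :
    Function.Surjective (evalHom : {p : X.Point // ⊤ ≤ p.hom ⁻¹ᵁ U} → _) := by
  intro χ
  have hle : U ≤ X.str ⁻¹ᵁ ⊤ := le_top
  have h : X.str.appLE ⊤ U hle ≫ CommRingCat.ofHom χ.toRingHom =
      (Scheme.ΓSpecIso (.of ℂ)).hom := by
    rw [← Iso.inv_comp_eq_id, ← Category.assoc]
    ext c
    exact χ.commutes c
  have hstr : (Spec.map (CommRingCat.ofHom χ.toRingHom) ≫ hU.fromSpec) ≫ X.str = 𝟙 _ := by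
    rw [Category.assoc, ← IsAffineOpen.SpecMap_appLE_fromSpec _ (isAffineOpen_top _) hU hle,
      ← Category.assoc, ← Spec.map_comp, h, specMap_ΓSpecIso_hom_comp_fromSpec]
  have hle' : ⊤ ≤ (Spec.map (CommRingCat.ofHom χ.toRingHom) ≫ hU.fromSpec) ⁻¹ᵁ U := by
    rw [Scheme.Hom.comp_preimage, hU.fromSpec_preimage_self]
    exact le_rfl
  refine ⟨⟨⟨_, hstr⟩, hle'⟩, ?_⟩
  have h1 := specMap_evalHom_comp_fromSpec hU ⟨⟨_, hstr⟩, hle'⟩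
  rw [cancel_mono] at h1
  have h2 := Spec.map_injective h1
  ext f
  exact congrArg (fun φ => φ.hom f) h2

theorem top_le_preimage_iff (p : X.Point) : ⊤ ≤ p.hom ⁻¹ᵁ U ↔ p.toPt ∈ U := by
  refine ⟨fun h => h trivial, fun h => (IsLocalRing.closed_point_mem_iff.mp h).ge⟩

theorem toPt_mem_basicOpen_iff (p : {p : X.Point // ⊤ ≤ p.hom ⁻¹ᵁ U}) (f : Γ(X.toScheme, U)) :
    p.1.toPt ∈ X.toScheme.basicOpen f ↔ evalHom p f ≠ 0 := by
  have h1 : p.1.toPt ∈ X.toScheme.basicOpen f ↔ (IsLocalRing.closedPoint ℂ : Spec (.of ℂ)) ∈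
      (Spec (.of ℂ)).basicOpen (p.1.hom.appLE U ⊤ p.2 f) := by
    rw [Scheme.basicOpen_appLE]
    exact ⟨fun h => ⟨trivial, h⟩, fun h => h.2⟩
  have h2 : evalHom p f = (Scheme.ΓSpecIso (.of ℂ)).hom.hom (p.1.hom.appLE U ⊤ p.2 f) := rfl
  rw [h1, h2]
  refine ⟨fun h h0 => ?_, fun h => ?_⟩
  · have h3 : p.1.hom.appLE U ⊤ p.2 f = 0 := by
      apply (Scheme.ΓSpecIso (.of ℂ)).commRingCatIsoToRingEquiv.injective
      rw [map_zero]
      exact h0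
    rw [h3] at h
    rw [Scheme.basicOpen_zero] at h
    exact h
  · have h3 : IsUnit (p.1.hom.appLE U ⊤ p.2 f) := by
      rw [← MulEquiv.isUnit_map (Scheme.ΓSpecIso (.of ℂ)).commRingCatIsoToRingEquiv]
      exact IsUnit.mk0 _ h
    rw [Scheme.basicOpen_of_isUnit _ h3]
    trivial

end Point

/-! ### Leaves and Zariski density -/

namespace Foliation

variable (G : X.Foliation)

/-- The complex point with given evaluation homomorphism. -/
noncomputable def _root_.ProjectiveManifold.Point.ofAlgHom (U : X.toScheme.affineOpens)
    (χ : Γ(X.toScheme, U) →ₐ[ℂ] ℂ) : {p : X.Point // ⊤ ≤ p.hom ⁻¹ᵁ U.1} :=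
  (Point.evalHom_surjective U.2 χ).choose

theorem _root_.ProjectiveManifold.Point.evalHom_ofAlgHom (U : X.toScheme.affineOpens)
    (χ : Γ(X.toScheme, U) →ₐ[ℂ] ℂ) : Point.evalHom (Point.ofAlgHom U χ) = χ :=
  (Point.evalHom_surjective U.2 χ).choose_spec

theorem _root_.ProjectiveManifold.Point.ofAlgHom_evalHom (U : X.toScheme.affineOpens)
    (p : {p : X.Point // ⊤ ≤ p.hom ⁻¹ᵁ U.1}) : Point.ofAlgHom U (Point.evalHom p) = p :=
  Point.evalHom_injective U.2 (Point.evalHom_ofAlgHom U _)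

/-- An integral curve of a section of the tangent sheaf which avoids the singular set
is a leafwise arc. -/
theorem leafArc_of_hasDerivWithinAt {U : X.toScheme.affineOpens}
    {v : Derivation ℂ Γ(X.toScheme, U) Γ(X.toScheme, U)} (hv : v ∈ G.tangent U)
    (γ : ℝ → Γ(X.toScheme, U) →ₐ[ℂ] ℂ) (c : ℂ)
    (hsing : ∀ t ∈ Set.Icc (0 : ℝ) 1, (Point.ofAlgHom U (γ t)).1.toPt ∉ G.sing)
    (hγ : ∀ f, ∀ t ∈ Set.Icc (0 : ℝ) 1,
      HasDerivWithinAt (fun s => γ s f) (c * γ t (v f)) (Set.Icc 0 1) t) :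
    G.LeafArc (Point.ofAlgHom U (γ 0)).1 (Point.ofAlgHom U (γ 1)).1 := by
  have heval : ∀ t f, Point.eval (Point.ofAlgHom U (γ t)) f = γ t f := fun t f =>
    AlgHom.congr_fun (Point.evalHom_ofAlgHom U (γ t)) f
  have hU := uniqueDiffOn_Icc (zero_lt_one (α := ℝ))
  have hder : ∀ f, ∀ t ∈ Set.Icc (0 : ℝ) 1,
      derivWithin (fun s => γ s f) (Set.Icc 0 1) t = c * γ t (v f) :=
    fun f t ht => (hγ f t ht).derivWithin (hU t ht)
  refine ⟨U, fun t => Point.ofAlgHom U (γ t), rfl, rfl, hsing, fun f => ?_,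
    fun n g f h t ht => ?_⟩
  · simp only [heval]
    refine (contDiffOn_one_iff_derivWithin hU).mpr
      ⟨fun t ht => (hγ f t ht).differentiableWithinAt, ?_⟩
    refine ContinuousOn.congr (f := fun t => c * γ t (v f)) ?_ (hder f)
    exact continuousOn_const.mul fun t ht => (hγ (v f) t ht).continuousWithinAt
  · simp only [heval, hder _ t ht]
    have h1 := congrArg (γ t) ((G.mem_tangent_iff U v).mp hv _ h)
    simp only [map_sum, map_smul, Derivation.liftKaehlerDifferential_comp_D, map_zero,
      smul_eq_mul, map_mul] at h1
    rw [← mul_zero c, ← h1, Finset.mul_sum]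
    exact Finset.sum_congr rfl fun i _ => by ring

/-- The open set witnessing that `x` is nonsingular witnesses it for all its points. -/
theorem exists_basicOpen_disjoint_sing (U : X.toScheme.affineOpens) {x : X.toScheme}
    (hxU : x ∈ U.1) (hx : x ∉ G.sing) :
    ∃ h : Γ(X.toScheme, U), x ∈ X.toScheme.basicOpen h ∧
      ∀ y ∈ X.toScheme.basicOpen h, y ∉ G.sing := by
  obtain ⟨V, hxV, hV⟩ := not_not.mp hx
  obtain ⟨h, hle, hxh⟩ := U.2.exists_basicOpen_le (V := V.1) ⟨x, hxV⟩ hxU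
  exact ⟨h, hxh, fun y hy => not_not.mpr ⟨V, hle hy, hV⟩⟩

variable {G}

theorem toPt_notMem_sing_of_mem_leaf {x y : X.Point} (hx : x.toPt ∉ G.sing) (hy : y ∈ G.leaf x) :
    y.toPt ∉ G.sing := by
  rcases Relation.ReflTransGen.cases_tail hy with rfl | ⟨z, -, U, γ, -, h1, h2, -⟩
  · exact hx
  · exact h1 ▸ h2 1 ⟨zero_le_one, le_rfl⟩

/-- The regular functions on `U` vanishing on a leaf are stable under the tangent sheaf. -/
theorem evalHom_apply_eq_zero_of_leaf {U : X.toScheme.affineOpens} {x : X.Point}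
    (hx : x.toPt ∉ G.sing) {f : Γ(X.toScheme, U)}
    (hf : ∀ p : {p : X.Point // ⊤ ≤ p.hom ⁻¹ᵁ U.1}, p.1 ∈ G.leaf x → Point.evalHom p f = 0)
    {v : Derivation ℂ Γ(X.toScheme, U) Γ(X.toScheme, U)} (hv : v ∈ G.tangent U)
    (p : {p : X.Point // ⊤ ≤ p.hom ⁻¹ᵁ U.1}) (hp : p.1 ∈ G.leaf x) :
    Point.evalHom p (v f) = 0 := by
  have hps := toPt_notMem_sing_of_mem_leaf hx hp
  obtain ⟨h, hph, hsing⟩ := G.exists_basicOpen_disjoint_sing U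
    ((Point.top_le_preimage_iff p.1).mp p.2) hps
  obtain ⟨γ, ε, hε, h0, hne, hder⟩ := v.exists_integralCurve (Point.evalHom p)
    ((Point.toPt_mem_basicOpen_iff p h).mp hph)
  have hγ0 : Point.ofAlgHom U (γ 0) = p := by rw [h0, Point.ofAlgHom_evalHom]
  -- Reparametrizing by `t ↦ s t` turns the piece of curve over `[0, s]` into an arc over `[0, 1]`,
  -- so every `γ s` lies in the leaf. Then `f` vanishes along `γ`, and its derivative at `0` is `ε
  -- v(f)(p)`.
  have hleaf : ∀ s ∈ Set.Icc (0 : ℝ) 1, (Point.ofAlgHom U (γ s)).1 ∈ G.leaf x := by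
    intro s hs
    have hst : Set.MapsTo (fun t : ℝ => s * t) (Set.Icc 0 1) (Set.Icc 0 1) := fun t ht =>
      ⟨mul_nonneg hs.1 ht.1, mul_le_one₀ hs.2 ht.1 ht.2⟩
    have harc := G.leafArc_of_hasDerivWithinAt hv (fun t => γ (s * t)) (s * ε)
      (fun t ht => hsing _ ((Point.toPt_mem_basicOpen_iff _ h).mpr (by
        rw [Point.evalHom_ofAlgHom]; exact hne _ (hst ht))))
      (fun g t ht => by
        have h1 : HasDerivWithinAt (fun t : ℝ => s * t) s (Set.Icc 0 1) t := by
          simpa using ((hasDerivAt_id t).const_mul s).hasDerivWithinAt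
        have h2 := (hder g (s * t) (hst ht)).scomp t h1 hst
        rw [Complex.real_smul, ← mul_assoc] at h2
        exact h2)
    simp only [mul_zero, mul_one, hγ0] at harc
    exact Relation.ReflTransGen.tail hp harc
  have h0I : (0 : ℝ) ∈ Set.Icc (0 : ℝ) 1 := ⟨le_rfl, zero_le_one⟩
  have hzero : ∀ s ∈ Set.Icc (0 : ℝ) 1, γ s f = 0 := fun s hs => by
    have := hf _ (hleaf s hs)
    rwa [Point.evalHom_ofAlgHom] at this
  have hd : HasDerivWithinAt (fun s => γ s f) 0 (Set.Icc 0 1) 0 :=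
    (hasDerivWithinAt_const 0 _ (0 : ℂ)).congr hzero (hzero 0 h0I)
  have := (uniqueDiffOn_Icc (zero_lt_one (α := ℝ)) 0 h0I).eq_deriv _ (hder f 0 h0I) hd
  rw [h0] at this
  exact (mul_eq_zero.mp this).resolve_left (by exact_mod_cast hε.ne')

theorem evalHom_iterate_eq_zero_of_leaf {U : X.toScheme.affineOpens} {x : X.Point}
    (hx : x.toPt ∉ G.sing) {f : Γ(X.toScheme, U)}
    (hf : ∀ p : {p : X.Point // ⊤ ≤ p.hom ⁻¹ᵁ U.1}, p.1 ∈ G.leaf x → Point.evalHom p f = 0)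
    (w : List (Derivation ℂ Γ(X.toScheme, U) Γ(X.toScheme, U))) (hw : ∀ v ∈ w, v ∈ G.tangent U)
    (p : {p : X.Point // ⊤ ≤ p.hom ⁻¹ᵁ U.1}) (hp : p.1 ∈ G.leaf x) :
    Point.evalHom p (Derivation.iterate w f) = 0 := by
  induction w generalizing p with
  | nil => exact hf p hp
  | cons v w ih =>
    rw [List.forall_mem_cons] at hw
    exact evalHom_apply_eq_zero_of_leaf hx (ih hw.2) hw.1 p hp

theorem mem_firstIntegrals_of_tangent (U : X.toScheme.affineOpens) [Nonempty U.1] {f : X.RatFun}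
    (hf : ∀ v ∈ G.tangent U, ∀ w : X.RatVectorField, w.Extends v → w f = 0) :
    f ∈ G.firstIntegrals := by
  intro w hw
  obtain ⟨a, ha, v, hv, hext⟩ := G.exists_smul_extends_mem_tangent U (G.mem_ratTangent_iff.mp hw)
  exact (mul_eq_zero.mp (hf v hv _ hext)).resolve_left
    (IsFractionRing.to_map_ne_zero_of_mem_nonZeroDivisors ha)

/-- A polynomial ring has countably many monomials. Hence there are only countably many Wronskians
to avoid. -/
theorem _root_.Algebra.FiniteType.countable_basis {ι A : Type} [CommRing A] [Algebra ℂ A]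
    [Algebra.FiniteType ℂ A] (b : Module.Basis ι ℂ A) : Countable ι := by
  obtain ⟨n, φ, hφ⟩ := Algebra.FiniteType.iff_quotient_mvPolynomial''.mp
    (inferInstance : Algebra.FiniteType ℂ A)
  rw [← Cardinal.mk_le_aleph0_iff, b.mk_eq_rank'']
  refine (LinearMap.rank_le_of_surjective φ.toLinearMap hφ).trans ?_
  rw [← (MvPolynomial.basisMonomials (Fin n) ℂ).mk_eq_rank'']
  exact Cardinal.mk_le_aleph0

/-- If a foliation has only constant rational first integrals then its general leaf is
Zariski dense. -/
theorem generalLeafZariskiDense_of_firstIntegrals (h : G.firstIntegrals = ⊥) :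
    G.GeneralLeafZariskiDense := by
  classical
  obtain ⟨U, hU⟩ := X.nonempty_affineOpens
  let b := Module.Free.chooseBasis ℂ Γ(X.toScheme, U)
  let ι := Module.Free.ChooseBasisIndex ℂ Γ(X.toScheme, U)
  have hι : Countable ι := Algebra.FiniteType.countable_basis b
  let T : Set (Derivation ℂ Γ(X.toScheme, U) Γ(X.toScheme, U)) := G.tangent U
  have hconst : ∀ f : X.RatFun, (∀ v ∈ T, ∀ w : X.RatVectorField,
      w.Extends v → w f = 0) → ∃ c : ℂ, algebraMap ℂ X.RatFun c = f := by
    intro f hf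
    have := mem_firstIntegrals_of_tangent U hf
    rwa [h, IntermediateField.mem_bot] at this
  have hW : ∀ S : Finset ι, ∃ W : S → List (Derivation ℂ Γ(X.toScheme, U) Γ(X.toScheme, U)),
      (∀ i, ∀ v ∈ W i, v ∈ T) ∧
        (Matrix.of fun i j : S => Derivation.iterate (W i) (b j)).det ≠ 0 := fun S =>
    Derivation.exists_wronskian_ne_zero (K := X.RatFun) _ hconst
      (b.linearIndependent.comp ((↑) : S → ι) Subtype.val_injective)
  choose W hWT hdet using hW
  obtain ⟨e, he⟩ := exists_surjective_nat (Finset ι)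
  let D (S : Finset ι) : X.toScheme.Opens :=
    X.toScheme.basicOpen (Matrix.of fun i j : S => Derivation.iterate (W S i) (b j)).det
  refine ⟨fun n => ((D (e n) : Set X.toScheme))ᶜ, fun n => ⟨(D (e n)).2.isClosed_compl, ?_⟩,
    fun x hx hxD => ?_⟩
  · rw [Ne, Set.compl_univ_iff, TopologicalSpace.Opens.coe_eq_empty]
    exact fun h0 => hdet (e n) ((basicOpen_eq_bot_iff _).mp h0)
  have hxD' : ∀ S, x.toPt ∈ D S := fun S => by
    obtain ⟨n, rfl⟩ := he S
    exact not_not.mp (hxD n)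
  -- The empty Wronskian is `1`, so `D ∅ = U` and the complement of `U` is among the excluded closed
  -- sets.
  have hxU : x.toPt ∈ U.1 := X.toScheme.basicOpen_le _ (hxD' ∅)
  rw [dense_iff_inter_open]
  intro V hV hVne
  by_contra hempty
  have hVne' : Nonempty (⟨V, hV⟩ : X.toScheme.Opens) := hVne.to_subtype
  obtain ⟨⟨z, hzV, hzU⟩⟩ := nonempty_inf (⟨V, hV⟩ : X.toScheme.Opens) U.1
  obtain ⟨f, hfV, hzf⟩ := U.2.exists_basicOpen_le (V := ⟨V, hV⟩) ⟨z, hzV⟩ hzU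
  -- If the leaf missed `V`, the function `f`, whose nonvanishing locus lies in `V`, would vanish on
  -- the whole part of the leaf in `U`.
  have hf : ∀ p : {p : X.Point // ⊤ ≤ p.hom ⁻¹ᵁ U.1}, p.1 ∈ G.leaf x → Point.evalHom p f = 0 := by
    intro p hp
    by_contra hne
    exact hempty ⟨p.1.toPt, hfV ((Point.toPt_mem_basicOpen_iff p f).mpr hne), p.1, hp, rfl⟩
  let p : {p : X.Point // ⊤ ≤ p.hom ⁻¹ᵁ U.1} := ⟨x, (Point.top_le_preimage_iff x).mpr hxU⟩
  let S := (b.repr f).support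
  have hsum : ∑ j : S, b.repr f j • b j = f := by
    rw [Finset.sum_coe_sort S fun j => b.repr f j • b j]
    exact b.linearCombination_repr f
  have h0 := Derivation.sum_smul_eq_zero_of_iterate (f := fun j : S => b j) (Point.evalHom p)
    ((Point.toPt_mem_basicOpen_iff p _).mp (hxD' S)) (fun j => b.repr f j) fun i => by
      rw [hsum]
      exact evalHom_iterate_eq_zero_of_leaf hx hf _ (hWT S i) p Relation.ReflTransGen.refl
  rw [hsum] at h0
  rw [h0, Scheme.basicOpen_zero] at hzf
  exact hzf

end Foliation

end ProjectiveManifold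

theorem corollaryC (X : ProjectiveManifold) (q : ℕ) (hq : 2 < q)
    (G : X.Foliation) (hcodim : G.codim = q)
    (η : G.RatLeafForm) (hη : ¬ G.IsLogExact η) (hgen : G.IsGeneratedByEigenspace η) :
    (G.GeneralLeafZariskiDense ∧ G.firstIntegrals = ⊥) ∧
    (∀ F : X.Foliation, F.codim = 1 → F.Contains G → F.IsTransverselyAffine) ∧
    ∃ (b : Module.Basis (Fin q) ℂ (G.eigenspace η))
      (Φ : ℙ ℂ (Fin q → ℂ) ≃ {F : X.Foliation // F.codim = 1 ∧ F.Contains G}),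
      ∀ (s : Fin q → ℂ) (hs : s ≠ 0),
        (Φ (Projectivization.mk ℂ s hs)).1.IsDefinedBy
          (∑ i, s i • (b i : X.RatForm)) := by
  obtain ⟨B⟩ := ProjectiveManifold.Foliation.exists_eigenFrame hcodim hgen
  obtain ⟨α, hα⟩ := B.exists_connection_form hq hη hgen
  have hbot := B.firstIntegrals_eq_bot hη
  refine ⟨⟨ProjectiveManifold.Foliation.generalLeafZariskiDense_of_firstIntegrals hbot, hbot⟩,
    fun F hF hFG => ?_, B.basis hη, ?_⟩
  · obtain ⟨s, -, hs⟩ := B.exists_isDefinedBy_comb hη hF hFG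
    exact ⟨B.comb s, α, hs, B.exteriorDerivative_comb hα s, B.exteriorDerivative_eq_zero hq hα⟩
  · simp only [B.coe_basis]
    exact B.exists_equiv hη hα
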